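/- Let $\mathcal{X}$ be a measurable space, $\mathcal{Y}=\{\pm1\}$, $\mathcal{H}\subseteq\mathcal{Y}^{\mathcal{X}}$ a hypothesis class, $\mathcal{T}$ a finite non-empty collection of maps $T:\mathcal{X}\to\mathcal{X}$, and $\mathcal{D}$ a probability distribution on $\mathcal{X}\times\mathcal{Y}$. Put $\mathrm{err}(h,T(\mathcal{D}))=\Pr_{(x,y)\sim\mathcal{D}}[h(T(x))\neq y]$, $\mathsf{OPT}_T=\inf_{h\in\mathcal{H}}\mathrm{err}(h,T(\mathcal{D}))$ and $\mathcal{H}\circ\mathcal{T}=\{h\circ T: h\in\mathcal{H},T\in\mathcal{T}\}$. Assume that $\mathcal{H}\circ\mathcal{T}$ has finite VC dimension and is a $\mathcal{D}$-measurable class: its members are measurable, and for all $n$ and $e\in\mathbb{R}^n$ the map $((x_i,y_i))_{i\le n}\mapsto\sup_{f\in\mathcal{H}\circ\mathcal{T}}\bigl|\sum_{i}e_i\mathbf{1}[f(x_i)\neq y_i]\bigr|$ is measurable with respect to the completion of $\mathcal{D}^n$ (this holds, for example, if $\mathcal{H}\circ\mathcal{T}$ is a countable class of measurable functions). Let $\mathtt{ERM}$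 be an empirical risk minimizer for $\mathcal{H}$: it maps every finite dataset to a member of $\mathcal{H}$ of smallest empirical error on that dataset. Given a dataset $S=((x_1,y_1),\dots,(x_m,y_m))$, write $T(S)=((T(x_i),y_i))_{i\le m}$ and $\mathrm{err}(h,T(S))=\frac1m\sum_{i}\mathbf{1}[h(T(x_i))\neq y_i]$. For integers $R\geq1$ and $k$, consider the following randomized algorithm. Let $\hat h_T$ be the output of $\mathtt{ERM}$ on $T(S)$, for each $T\in\mathcal{T}$; let $Q_1$ be uniform on $\mathcal{T}$ and $\eta=\sqrt{8\ln|\mathcal{T}|/R}$. In round $r=1,\dots,R$, draw $k$ i.i.d. examples $(T(x),y)$ with $T\sim Q_r$ and, independently, $(x,y)$ uniform in $S$; let $h_r$ be the output of $\mathtt{ERM}$ on these $k$ examples; and put $$Q_{r+1}(T)=\frac{1}{Z_r}\,Q_r(T)\exp\bigl(\eta\,(\mathrm{err}(h_r,T(S))-\mathrm{err}(\hat h_T,T(S)))\bigr),$$ where $Z_r$ makes $Q_{r+1}$ a distribution. The output is the randomized predictor $\bar h=\frac1R\sum_{r=1}^R h_r$, with $\mathrm{err}(\bar h,T(\mathcal{D}))=\frac1R\sum_{r=1}^R\mathrm{err}(h_r,T(\mathcal{D}))$.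 Theorem 6. There is a universal constant $C>0$ such that, for all $\mathcal{X},\mathcal{H},\mathcal{T},\mathcal{D},\mathtt{ERM}$ as above, all $\varepsilon,\delta,\gamma\in(0,\frac12)$, and all integers $m\geq1$, $R\geq1$ and $k$ with $$m\geq C\,\frac{\mathrm{vc}(\mathcal{H}\circ\mathcal{T})+\log(1/\delta)}{\varepsilon^2},\qquad R\geq\frac{8\ln|\mathcal{T}|}{\varepsilon^2},\qquad k\geq C\,\frac{\min\{\mathrm{vc}(\mathcal{H}),\,m|\mathcal{T}|\}+\log(R/\gamma)}{\varepsilon^2},$$ the following holds with probability at least $1-\delta$ over $S\sim\mathcal{D}^m$: with probability at least $1-\gamma$ over the internal random draws of the algorithm on $S$, $$\forall T\in\mathcal{T}:\quad \mathrm{err}(\bar h,T(\mathcal{D}))-\mathsf{OPT}_T\;\leq\;\inf_{h^\star\in\mathcal{H}}\sup_{T'\in\mathcal{T}}\bigl\{\mathrm{err}(h^\star,T'(\mathcal{D}))-\mathsf{OPT}_{T'}\bigr\}+\varepsilon .$$ -/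

import Mathlib

universe u

open MeasureTheory
open scoped ENNReal

namespace TransformationLearning

noncomputable section

/-! The two labels are modelled by `Bool`; a predictor is a map `X → Bool`, a labelled example is an
element of `X × Bool`, a dataset of size `n` is a map `Fin n → X × Bool`. -/

variable {X : Type u}

/-! ### Hypothesis classes and the VC dimension -/

/-- The composition `H ∘ 𝒯 = {h ∘ T : h ∈ H, T ∈ 𝒯}`. -/
def compClass (H : Set (X → Bool)) (𝒯 : Finset (X → X)) : Set (X → Bool) :=
  {f | ∃ h ∈ H, ∃ T ∈ 𝒯, f = h ∘ T}

/-- `𝒞` shatters the finite set `A`: every labelling of `A` is realised by a member of `𝒞`. -/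
def Shatters (𝒞 : Set (X → Bool)) (A : Finset X) : Prop :=
  ∀ g : X → Bool, ∃ f ∈ 𝒞, ∀ x ∈ A, f x = g x

/-- The VC dimension, the supremum of the sizes of the shattered finite sets. -/
def vcDim (𝒞 : Set (X → Bool)) : ℕ∞ :=
  ⨆ (A : Finset X) (_ : Shatters 𝒞 A), (A.card : ℕ∞)

/-! ### Errors -/

/-- The zero-one loss of `f` on a labelled example. -/
def loss (f : X → Bool) (p : X × Bool) : ℝ := if f p.1 ≠ p.2 then 1 else 0

/-- The empirical error of `h` on the dataset `S`. -/
def empErr {n : ℕ} (h : X → Bool) (S : Fin n → X × Bool) : ℝ :=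
  (∑ i, loss h (S i)) / n

/-- The transformed dataset `T(S)`: the instances are transformed, the labels are kept. -/
def transform {n : ℕ} (T : X → X) (S : Fin n → X × Bool) : Fin n → X × Bool :=
  fun i => (T (S i).1, (S i).2)

/-- `err(h, T(D))`, the probability over `(x, y) ∼ D` that `h (T x) ≠ y`. -/
def err [MeasurableSpace X] (D : Measure (X × Bool)) (h : X → Bool) (T : X → X) : ℝ :=
  D.real {p | h (T p.1) ≠ p.2}

/-- The error on `T(D)` of the randomized predictor `(1 / R) ∑ r, h r`, which answers with `h r` for
a uniformly random `r`. -/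
def avgErr [MeasurableSpace X] (D : Measure (X × Bool)) {R : ℕ} (h : Fin R → X → Bool)
    (T : X → X) : ℝ :=
  (∑ r, err D (h r) T) / R

/-- `OPT_T`, the smallest error on `T(D)` achievable in `H`. -/
def opt [MeasurableSpace X] (D : Measure (X × Bool)) (H : Set (X → Bool)) (T : X → X) : ℝ :=
  ⨅ h : H, err D h T

/-- The optimal worst-case regret `inf_{h ∈ H} sup_{T ∈ 𝒯} (err(h, T(D)) - OPT_T)`. -/
def optRegret [MeasurableSpace X] (D : Measure (X × Bool)) (H : Set (X → Bool))
    (𝒯 : Finset (X → X)) : ℝ :=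
  ⨅ h : H, ⨆ T : 𝒯, (err D h T - opt D H T)

/-- The usual measurability convention of empirical process theory (a `D`-measurable class, as in
van der Vaart and Wellner): the members of `𝒞` are measurable, and suprema over `𝒞` of weighted sums
of losses over a sample are measurable for the completion of `D^n`. It holds for every countable
class of measurable functions. -/
def IsMeasurableClass [MeasurableSpace X] (D : Measure (X × Bool)) (𝒞 : Set (X → Bool)) : Prop :=
  (∀ f ∈ 𝒞, Measurable f) ∧
    ∀ (n : ℕ) (e : Fin n → ℝ),
      AEMeasurable (fun S : Fin n → X × Bool => ⨆ f : 𝒞, |∑ i, e i * loss f (S i)|)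
        (Measure.pi fun _ : Fin n => D)

/-! ### The oracle -/

/-- A learner maps datasets of any size to predictors. -/
abbrev Learner (X : Type u) : Type u := (n : ℕ) → (Fin n → X × Bool) → (X → Bool)

/-- `erm` is an empirical risk minimizer for `H`. -/
def IsERM (H : Set (X → Bool)) (erm : Learner X) : Prop :=
  ∀ (n : ℕ) (S : Fin n → X × Bool),
    erm n S ∈ H ∧ ∀ h ∈ H, empErr (erm n S) S ≤ empErr h S

/-! ### The algorithm -/

/-- The law of `k` i.i.d. draws from `p`. -/
def iid {α : Type u} (p : PMF α) : (k : ℕ) → PMF (Fin k → α)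
  | 0 => PMF.pure Fin.elim0
  | k + 1 => p.bind fun a => (iid p k).bind fun as => PMF.pure (Fin.cons a as)

/-- The law of `(T x, y)` for `T ∼ Q` and, independently, `(x, y)` uniform in the dataset `S`. -/
def mixture {𝒯 : Finset (X → X)} {m : ℕ} [NeZero m] (S : Fin m → X × Bool) (Q : PMF 𝒯) :
    PMF (X × Bool) :=
  Q.bind fun T => (PMF.uniformOfFintype (Fin m)).map fun i => transform T.1 S i

/-- The unnormalized multiplicative weights. -/
def mwWeight {𝒯 : Finset (X → X)} (η : ℝ) (gain : 𝒯 → ℝ) (Q : PMF 𝒯) (T : 𝒯) : ℝ≥0∞ :=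
  Q T * ENNReal.ofReal (Real.exp (η * gain T))

theorem mwWeight_sum_ne_zero {𝒯 : Finset (X → X)} (η : ℝ) (gain : 𝒯 → ℝ) (Q : PMF 𝒯) :
    ∑' T, mwWeight η gain Q T ≠ 0 := by
  obtain ⟨T, hT⟩ := Q.support_nonempty
  intro h
  have h0 := ENNReal.tsum_eq_zero.1 h T
  rcases mul_eq_zero.1 h0 with h1 | h1
  · exact (Q.mem_support_iff T).1 hT h1
  · exact absurd (ENNReal.ofReal_eq_zero.1 h1) (not_le.2 (Real.exp_pos _))

theorem mwWeight_sum_ne_top {𝒯 : Finset (X → X)} (η : ℝ) (gain : 𝒯 → ℝ) (Q : PMF 𝒯) :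
    ∑' T, mwWeight η gain Q T ≠ ∞ := by
  rw [tsum_fintype]
  exact ENNReal.sum_ne_top.2 fun T _ => ENNReal.mul_ne_top (Q.apply_ne_top T) ENNReal.ofReal_ne_top

/-- The multiplicative weights update: `Q T * exp (η * gain T) / Z`, with `Z` the normalization. -/
def mwUpdate {𝒯 : Finset (X → X)} (η : ℝ) (gain : 𝒯 → ℝ) (Q : PMF 𝒯) : PMF 𝒯 :=
  PMF.normalize (mwWeight η gain Q) (mwWeight_sum_ne_zero η gain Q) (mwWeight_sum_ne_top η gain Q)

/-- The empirical regret `err(h, T(S)) - err(ĥ_T, T(S))`, where `ĥ_T` is the output of the learner on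
`T(S)`. -/
def empRegret {m : ℕ} (erm : Learner X) (S : Fin m → X × Bool) (h : X → Bool) (T : X → X) : ℝ :=
  empErr h (transform T S) - empErr (erm m (transform T S)) (transform T S)

/-- The joint law, after `n` rounds of the reduction with step size `η` and `k` fresh examples in
each round, of the predictors `h_1, …, h_n` found so far and the current distribution `Q_{n+1}`. -/
def rounds {𝒯 : Finset (X → X)} [Nonempty 𝒯] {m : ℕ} [NeZero m] (erm : Learner X) (k : ℕ) (η : ℝ)
    (S : Fin m → X × Bool) : (n : ℕ) → PMF ((Fin n → X → Bool) × PMF 𝒯)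
  | 0 => PMF.pure (Fin.elim0, PMF.uniformOfFintype 𝒯)
  | n + 1 =>
      (rounds erm k η S n).bind fun st =>
        (iid (mixture S st.2) k).map fun sample =>
          (Fin.snoc st.1 (erm k sample),
            mwUpdate η (fun T : 𝒯 => empRegret erm S (erm k sample) T.1) st.2)

/-- The reduction of worst-case regret minimization to `erm`: the law of the predictors
`h_1, …, h_R` found in `R` rounds on the dataset `S`, with `k` fresh examples in each round and step
size `√(8 log |𝒯| / R)`. -/
def algorithm (erm : Learner X) (𝒯 : Finset (X → X)) [Nonempty 𝒯] (k R : ℕ) {m : ℕ} [NeZero m]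
    (S : Fin m → X × Bool) : PMF (Fin R → X → Bool) :=
  (rounds (𝒯 := 𝒯) erm k (Real.sqrt (8 * Real.log 𝒯.card / R)) S R).map Prod.fst

end

end TransformationLearning

open TransformationLearning

namespace TransformationLearning

open Finset

/-! ### Signed sums -/

/-- The sign attached to a Boolean. -/
def boolSign (b : Bool) : ℝ := if b then 1 else -1

theorem sum_exp_boolSign {ι : Type*} [Fintype ι] [DecidableEq ι] (a : ι → ℝ) :
    ∑ σ : ι → Bool, Real.exp (∑ i, boolSign (σ i) * a i)
      = ∏ i, (Real.exp (a i) + Real.exp (-a i)) := by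
  have h := Finset.prod_univ_sum (fun _ : ι => (univ : Finset Bool))
    (fun i b => Real.exp (boolSign b * a i))
  simp only [Fintype.piFinset_univ] at h
  simp only [Real.exp_sum]
  rw [← h]
  refine prod_congr rfl fun i _ => ?_
  simp [boolSign]

theorem card_lt_sum_boolSign_le {n : ℕ} (a : Fin n → ℝ) {t V : ℝ} (ht : 0 < t) (hV : 0 < V)
    (ha : ∑ i, a i ^ 2 ≤ V) :
    (#{σ : Fin n → Bool | t < ∑ i, boolSign (σ i) * a i} : ℝ)
      ≤ 2 ^ n * Real.exp (-t ^ 2 / (2 * V)) := by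
  set l := t / V with hl
  have hl0 : 0 < l := div_pos ht hV
  have h1 : (#{σ : Fin n → Bool | t < ∑ i, boolSign (σ i) * a i} : ℝ) * Real.exp (l * t)
      ≤ ∑ σ : Fin n → Bool, Real.exp (∑ i, boolSign (σ i) * (l * a i)) := by
    have h4 : (#{σ : Fin n → Bool | t < ∑ i, boolSign (σ i) * a i} : ℝ) * Real.exp (l * t) =
        ∑ σ ∈ ({σ : Fin n → Bool | t < ∑ i, boolSign (σ i) * a i} : Finset (Fin n → Bool)),
          Real.exp (l * t) := by
      rw [Finset.sum_const, nsmul_eq_mul]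
    rw [h4, Finset.sum_filter]
    refine Finset.sum_le_sum fun σ _ => ?_
    split_ifs with hσ
    · have : ∑ i, boolSign (σ i) * (l * a i) = l * ∑ i, boolSign (σ i) * a i := by
        rw [Finset.mul_sum]; exact Finset.sum_congr rfl fun i _ => by ring
      rw [this]
      exact Real.exp_le_exp.2 (mul_le_mul_of_nonneg_left hσ.le hl0.le)
    · exact (Real.exp_pos _).le
  have h2 : ∑ σ : Fin n → Bool, Real.exp (∑ i, boolSign (σ i) * (l * a i))
      ≤ 2 ^ n * Real.exp (l ^ 2 * V / 2) := by
    rw [sum_exp_boolSign]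
    have h3 : ∀ i ∈ (univ : Finset (Fin n)), Real.exp (l * a i) + Real.exp (-(l * a i))
        ≤ 2 * Real.exp ((l * a i) ^ 2 / 2) := fun i _ => by
      have := Real.cosh_le_exp_half_sq (l * a i)
      rw [Real.cosh_eq] at this
      linarith
    refine (Finset.prod_le_prod (fun i _ => by positivity) h3).trans ?_
    rw [Finset.prod_mul_distrib, Finset.prod_const, Finset.card_univ, Fintype.card_fin,
      ← Real.exp_sum]
    refine mul_le_mul_of_nonneg_left (Real.exp_le_exp.2 ?_) (by positivity)
    rw [← Finset.sum_div]
    simp only [mul_pow]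
    rw [← Finset.mul_sum]
    have := mul_le_mul_of_nonneg_left ha (sq_nonneg l)
    linarith
  have h3 := h1.trans h2
  rw [← le_div_iff₀ (Real.exp_pos _), mul_div_assoc, ← Real.exp_sub] at h3
  refine h3.trans (le_of_eq ?_)
  congr 2
  rw [hl]; field_simp; ring

/-- Hoeffding's inequality for signed sums, as a count of sign patterns. -/
theorem card_lt_abs_sum_boolSign_le {n : ℕ} (a : Fin n → ℝ) {t V : ℝ} (ht : 0 < t) (hV : 0 < V)
    (ha : ∑ i, a i ^ 2 ≤ V) :
    (#{σ : Fin n → Bool | t < |∑ i, boolSign (σ i) * a i|} : ℝ)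
      ≤ 2 ^ n * (2 * Real.exp (-t ^ 2 / (2 * V))) := by
  have h1 := card_lt_sum_boolSign_le a ht hV ha
  have h2 := card_lt_sum_boolSign_le (fun i => -a i) ht hV (by simpa using ha)
  have h3 : ({σ | t < |∑ i, boolSign (σ i) * a i|} : Finset (Fin n → Bool)) ⊆
      ({σ | t < ∑ i, boolSign (σ i) * a i} : Finset (Fin n → Bool)) ∪
        ({σ | t < ∑ i, boolSign (σ i) * -a i} : Finset (Fin n → Bool)) := by
    intro σ hσ
    simp only [mem_filter, mem_univ, true_and, mem_union, mul_neg, sum_neg_distrib] at hσ ⊢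
    exact lt_abs.1 hσ
  have h4 : (#{σ : Fin n → Bool | t < |∑ i, boolSign (σ i) * a i|} : ℝ) ≤
      #{σ : Fin n → Bool | t < ∑ i, boolSign (σ i) * a i} +
        #{σ : Fin n → Bool | t < ∑ i, boolSign (σ i) * -a i} := by
    exact_mod_cast (card_le_card h3).trans (card_union_le _ _)
  linarith

/-! ### Shattering and packing numbers -/

/-- The family `𝒜` of sets cuts out every subset of `s`. -/
def SetShatters {Ω : Type*} (𝒜 : Set (Set Ω)) (s : Finset Ω) : Prop :=
  ∀ t ⊆ s, ∃ A ∈ 𝒜, ∀ x ∈ s, x ∈ A ↔ x ∈ t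

/-- The preimages of the members of `𝒜`. -/
def preimageClass {Ω Ω' : Type*} (φ : Ω' → Ω) (𝒜 : Set (Set Ω)) : Set (Set Ω') :=
  (fun A => φ ⁻¹' A) '' 𝒜

theorem SetShatters.injOn {Ω Ω' : Type*} {φ : Ω' → Ω} {𝒜 : Set (Set Ω)} {s : Finset Ω'}
    (h : SetShatters (preimageClass φ 𝒜) s) : Set.InjOn φ s := by
  classical
  intro x hx y hy hxy
  by_contra hne
  obtain ⟨_, ⟨A, -, rfl⟩, hA⟩ := h {x} (by simpa using hx)
  have h1 := hA x hx
  have h2 := hA y hy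
  simp only [Set.mem_preimage, mem_singleton] at h1 h2
  rw [← hxy, h1] at h2
  exact hne (h2.1 trivial).symm

theorem SetShatters.card_le_of_preimageClass {Ω Ω' : Type*} {φ : Ω' → Ω} {𝒜 : Set (Set Ω)} {d : ℕ}
    (hd : ∀ s, SetShatters 𝒜 s → #s ≤ d) {s : Finset Ω'}
    (h : SetShatters (preimageClass φ 𝒜) s) : #s ≤ d := by
  classical
  rw [← card_image_of_injOn h.injOn]
  refine hd _ fun t _ => ?_
  obtain ⟨_, ⟨A, hA𝒜, rfl⟩, hA⟩ := h {x ∈ s | φ x ∈ t} (filter_subset _ _)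
  refine ⟨A, hA𝒜, fun x hx => ?_⟩
  obtain ⟨y, hy, rfl⟩ := mem_image.1 hx
  have := hA y hy
  simp only [Set.mem_preimage, mem_filter] at this
  tauto

open Classical in
/-- The traces of the members of `𝒜` on a finite sequence. -/
noncomputable def trace {Ω : Type*} {n : ℕ} (𝒜 : Set (Set Ω)) (φ : Fin n → Ω) :
    Finset (Finset (Fin n)) :=
  {u | ∃ A ∈ 𝒜, ∀ i, i ∈ u ↔ φ i ∈ A}

theorem card_le_of_trace_shatters {Ω : Type*} {n d : ℕ} {𝒜 : Set (Set Ω)}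
    (hd : ∀ s, SetShatters 𝒜 s → #s ≤ d) {φ : Fin n → Ω} {s : Finset (Fin n)}
    (hs : (trace 𝒜 φ).Shatters s) : #s ≤ d := by
  refine SetShatters.card_le_of_preimageClass (φ := φ) hd fun t ht => ?_
  obtain ⟨u, hu, rfl⟩ := hs ht
  simp only [trace, mem_filter, mem_univ, true_and] at hu
  obtain ⟨A, hA, h⟩ := hu
  refine ⟨_, ⟨A, hA, rfl⟩, fun i hi => ?_⟩
  simp [hi, h]

/-- A form of the Sauer–Shelah lemma with a free parameter. -/
theorem card_le_of_shatters_card_le {n d : ℕ} {𝒜 : Finset (Finset (Fin n))}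
    (hd : ∀ s, 𝒜.Shatters s → #s ≤ d) {x : ℝ} (hx : 0 < x) (hx1 : x ≤ 1) :
    (#𝒜 : ℝ) ≤ (1 / x) ^ d * (1 + x) ^ n := by
  have h1 : (#𝒜 : ℝ) ≤ #𝒜.shatterer := by exact_mod_cast card_le_card_shatterer 𝒜
  have h2 : (#𝒜.shatterer : ℝ) * x ^ d ≤ (1 + x) ^ n := by
    rw [← nsmul_eq_mul, ← sum_const]
    have h3 := sum_pow_mul_eq_add_pow x 1 (univ : Finset (Fin n))
    simp only [one_pow, mul_one, powerset_univ, card_univ, Fintype.card_fin] at h3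
    rw [add_comm, ← h3]
    refine (sum_le_sum (g := fun s => x ^ #s) fun s hs => ?_).trans
      (sum_le_sum_of_subset_of_nonneg (subset_univ _) fun _ _ _ => by positivity)
    exact pow_le_pow_of_le_one hx.le hx1 (hd s (mem_shatterer.1 hs))
  refine h1.trans ?_
  rw [one_div, inv_pow, inv_mul_eq_div, le_div_iff₀ (by positivity)]
  exact h2

/-- A sequence that meets the symmetric difference of any two members of a separated family. -/
theorem exists_separating_sequence {n s : ℕ} {P : Finset (Finset (Fin n))} {r : ℝ}
    (hP : ∀ A ∈ P, ∀ B ∈ P, A ≠ B → r * n < #(symmDiff A B)) (hn : 0 < n) (hP0 : P.Nonempty)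
    (hs : 2 * Real.log #P ≤ r * s) :
    ∃ φ : Fin s → Fin n, ∀ A ∈ P, ∀ B ∈ P, A ≠ B → ∃ i, φ i ∈ symmDiff A B := by
  by_contra! hcon
  have hN : (0 : ℝ) < #P := by exact_mod_cast hP0.card_pos
  have hn' : (0 : ℝ) < n := by exact_mod_cast hn
  have hsub : (univ : Finset (Fin s → Fin n)) ⊆
      P.offDiag.biUnion fun q => Fintype.piFinset fun _ : Fin s => (symmDiff q.1 q.2)ᶜ := by
    intro φ _
    obtain ⟨A, hA, B, hB, hAB, h⟩ := hcon φ
    refine mem_biUnion.2 ⟨(A, B), mem_offDiag.2 ⟨hA, hB, hAB⟩, ?_⟩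
    simpa only [Fintype.mem_piFinset, mem_compl] using h
  have hcard : ((n : ℝ) ^ s) ≤
      ∑ q ∈ P.offDiag, (n * Real.exp (-r)) ^ s := by
    have h1 := (card_le_card hsub).trans card_biUnion_le
    simp only [Fintype.card_piFinset, prod_const, card_univ, Fintype.card_fin,
      Fintype.card_pi] at h1
    have h2 : ((n : ℝ) ^ s) ≤ ∑ q ∈ P.offDiag, (#(symmDiff q.1 q.2)ᶜ : ℝ) ^ s := by
      exact_mod_cast h1
    refine h2.trans (sum_le_sum fun q hq => ?_)
    obtain ⟨hA, hB, hAB⟩ := mem_offDiag.1 hq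
    have h3 := hP _ hA _ hB hAB
    have h4 : (#(symmDiff q.1 q.2)ᶜ : ℝ) = n - #(symmDiff q.1 q.2) := by
      rw [card_compl, Nat.cast_sub (card_le_univ _), Fintype.card_fin]
    refine pow_le_pow_left₀ (by positivity) ?_ _
    rw [h4]
    have h5 : 1 - r ≤ Real.exp (-r) := by linarith [Real.add_one_le_exp (-r)]
    nlinarith
  rw [sum_const, nsmul_eq_mul, mul_pow, ← Real.exp_nat_mul] at hcard
  have h6 : Real.exp (s * -r) ≤ ((#P : ℝ) ^ 2)⁻¹ := by
    rw [← Real.exp_log (inv_pos.2 (pow_pos hN 2)), Real.log_inv, Real.log_pow]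
    refine Real.exp_le_exp.2 ?_
    push_cast
    linarith
  have h7 : (#P.offDiag : ℝ) < (#P : ℝ) ^ 2 := by
    rw [offDiag_card]
    have : #P * #P - #P < #P ^ 2 := by
      have := hP0.card_pos
      have : 0 < #P * #P := by positivity
      rw [sq]; omega
    exact_mod_cast this
  have hns : (0 : ℝ) < (n : ℝ) ^ s := by positivity
  have h8 : (#P.offDiag : ℝ) * Real.exp (s * -r) < 1 := by
    have h9 : (#P.offDiag : ℝ) * Real.exp (s * -r) ≤ #P.offDiag * ((#P : ℝ) ^ 2)⁻¹ :=
      mul_le_mul_of_nonneg_left h6 (by positivity)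
    refine h9.trans_lt ?_
    rw [← div_eq_mul_inv, div_lt_one (by positivity)]
    exact h7
  nlinarith

/-- Packing numbers of families of finite VC dimension are polynomial in the separation. -/
theorem log_card_le_of_separated {n d : ℕ} {P : Finset (Finset (Fin n))} {r : ℝ} (hr : 0 < r)
    (hr1 : r ≤ 1) (hd : ∀ s, P.Shatters s → #s ≤ d)
    (hP : ∀ A ∈ P, ∀ B ∈ P, A ≠ B → r * n < #(symmDiff A B)) :
    Real.log #P ≤ 2 * (d * Real.log (8 / r)) + 1 := by
  classical
  have hlog8 : 0 ≤ Real.log (8 / r) := Real.log_nonneg (by rw [le_div_iff₀ hr]; linarith)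
  have hrhs : 0 ≤ 2 * (d * Real.log (8 / r)) + 1 := by positivity
  rcases le_or_gt #P 1 with h1 | h1
  · refine (Real.log_nonpos (by positivity) (by exact_mod_cast h1)).trans hrhs
  have hP0 : P.Nonempty := card_pos.1 (by omega)
  have hn : 0 < n := by
    rcases Nat.eq_zero_or_pos n with rfl | h
    · have : #P ≤ 1 := by
        have := card_le_univ P
        simpa using this
      omega
    · exact h
  set L := Real.log #P with hL
  have hL0 : 0 ≤ L := Real.log_natCast_nonneg _
  set s := ⌈2 * L / r⌉₊ with hs
  have hs1 : 2 * L ≤ r * s := by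
    have := Nat.le_ceil (2 * L / r)
    rw [div_le_iff₀ hr] at this
    linarith
  have hs2 : r * s ≤ 2 * L + r := by
    have := Nat.ceil_lt_add_one (a := 2 * L / r) (by positivity)
    have h2 : r * (s : ℝ) ≤ r * (2 * L / r + 1) := mul_le_mul_of_nonneg_left this.le hr.le
    rw [mul_add, mul_div_cancel₀ _ hr.ne'] at h2
    linarith
  obtain ⟨φ, hφ⟩ := exists_separating_sequence hP hn hP0 hs1
  set Q : Set (Set (Fin n)) := {A | ∃ u ∈ P, A = ↑u} with hQ
  have hQd : ∀ s, SetShatters Q s → #s ≤ d := fun s h => hd s fun t ht => by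
    obtain ⟨_, ⟨u, hu, rfl⟩, h⟩ := h t ht
    refine ⟨u, hu, ?_⟩
    ext x
    have := h x
    simp only [mem_coe, mem_inter] at this ⊢
    exact ⟨fun h => (this h.1).1 h.2, fun h => ⟨ht h, (this (ht h)).2 h⟩⟩
  have hcard : #P ≤ #(trace Q φ) := by
    refine card_le_card_of_injOn (fun u => univ.filter fun i => φ i ∈ u) (fun u hu => ?_) ?_
    · simp only [trace, mem_coe, mem_univ, true_and, mem_filter]
      exact ⟨u, ⟨u, mem_coe.1 hu, rfl⟩, fun i => by simp⟩
    · intro A hA B hB hAB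
      by_contra hne
      obtain ⟨i, hi⟩ := hφ A hA B hB hne
      have := congrArg (i ∈ ·) hAB
      simp only [mem_filter, mem_univ, true_and, eq_iff_iff] at this
      rw [mem_symmDiff] at hi
      tauto
  have h3 := card_le_of_shatters_card_le (fun s => card_le_of_trace_shatters hQd (φ := φ) (s := s))
    (x := r / 8) (by positivity) (by linarith)
  have h4 : (#P : ℝ) ≤ Real.exp (d * Real.log (8 / r) + s * (r / 8)) := by
    refine ((Nat.cast_le.2 hcard).trans h3).trans ?_
    rw [Real.exp_add, Real.exp_nat_mul, Real.exp_log (by positivity), Real.exp_nat_mul, one_div_div]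
    refine mul_le_mul_of_nonneg_left (pow_le_pow_left₀ (by positivity) ?_ _) (by positivity)
    linarith [Real.add_one_le_exp (r / 8)]
  have h5 : L ≤ d * Real.log (8 / r) + s * (r / 8) := by
    rw [hL, Real.log_le_iff_le_exp (by exact_mod_cast hP0.card_pos)]
    exact h4
  nlinarith

theorem exists_separated_net {n : ℕ} (𝒜 : Finset (Finset (Fin n))) (c : ℝ) :
    ∃ P ⊆ 𝒜, (∀ A ∈ P, ∀ B ∈ P, A ≠ B → c < #(symmDiff A B)) ∧
      ∀ A ∈ 𝒜, ∃ B ∈ P, (#(symmDiff A B) : ℝ) ≤ c ∨ A = B := by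
  classical
  obtain ⟨P, hP, hmax⟩ := exists_max_image
    (𝒜.powerset.filter fun P => ∀ A ∈ P, ∀ B ∈ P, A ≠ B → c < #(symmDiff A B)) card
    ⟨∅, by simp⟩
  simp only [mem_filter, mem_powerset] at hP hmax
  refine ⟨P, hP.1, hP.2, fun A hA => ?_⟩
  by_contra! hcon
  have hAP : A ∉ P := fun h => (hcon A h).2 rfl
  have := hmax (insert A P) ⟨insert_subset hA hP.1, ?_⟩
  · rw [card_insert_of_notMem hAP] at this
    omega
  · intro B hB C hC hBC
    rcases mem_insert.1 hB with rfl | hB' <;> rcases mem_insert.1 hC with rfl | hC'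
    · exact absurd rfl hBC
    · exact (hcon C hC').1
    · rw [symmDiff_comm]; exact (hcon B hB').1
    · exact hP.2 B hB' C hC' hBC

/-! ### Chaining -/

theorem card_lt_abs_sub_boolSign_le {n : ℕ} (A B : Finset (Fin n)) {t V : ℝ} (ht : 0 < t)
    (hV : 0 < V) (h : (#(symmDiff A B) : ℝ) ≤ V) :
    (#{σ : Fin n → Bool | t < |∑ i ∈ A, boolSign (σ i) - ∑ i ∈ B, boolSign (σ i)|} : ℝ)
      ≤ 2 ^ n * (2 * Real.exp (-t ^ 2 / (2 * V))) := by
  set a : Fin n → ℝ := fun i => (if i ∈ A then 1 else 0) - (if i ∈ B then 1 else 0) with ha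
  have h1 : ∀ σ : Fin n → Bool, ∑ i ∈ A, boolSign (σ i) - ∑ i ∈ B, boolSign (σ i)
      = ∑ i, boolSign (σ i) * a i := fun σ => by
    simp only [ha, mul_sub, sum_sub_distrib, mul_ite, mul_one, mul_zero, sum_ite_mem, univ_inter]
  have h2 : ∑ i, a i ^ 2 = #(symmDiff A B) := by
    rw [card_eq_sum_ones, Nat.cast_sum, ← sum_filter_add_sum_filter_not univ (· ∈ symmDiff A B)]
    have : ∑ i ∈ univ.filter (· ∉ symmDiff A B), a i ^ 2 = 0 := by
      refine sum_eq_zero fun i hi => ?_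
      simp only [mem_filter, mem_univ, true_and, mem_symmDiff, not_or, not_and, not_not] at hi
      by_cases hA : i ∈ A
      · simp [ha, hA, hi.1 hA]
      · have : i ∉ B := fun h => hA (hi.2 h)
        simp [ha, hA, this]
    rw [this, add_zero, filter_mem_eq_inter, univ_inter]
    refine sum_congr rfl fun i hi => ?_
    rcases mem_symmDiff.1 hi with ⟨h1, h2⟩ | ⟨h1, h2⟩ <;> simp [ha, h1, h2]
  simp only [h1]
  exact card_lt_abs_sum_boolSign_le a ht hV (h2.trans_le h)

/-- The union bound over the links `A ↦ p A` of a chain, and its numerical evaluation. -/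
theorem card_exists_link_le {n : ℕ} (P : Finset (Finset (Fin n)))
    (p : Finset (Fin n) → Finset (Fin n)) {t V c b : ℝ} (ht : 0 < t) (hV : 0 < V)
    (h : ∀ A ∈ P, (#(symmDiff A (p A)) : ℝ) ≤ V) (hP : Real.log #P ≤ c)
    (hb : c + 1 - t ^ 2 / (2 * V) ≤ b) :
    (#{σ : Fin n → Bool | ∃ A ∈ P,
        t < |∑ i ∈ A, boolSign (σ i) - ∑ i ∈ p A, boolSign (σ i)|} : ℝ) ≤ 2 ^ n * Real.exp b := by
  have h1 : ({σ | ∃ A ∈ P, t < |∑ i ∈ A, boolSign (σ i) - ∑ i ∈ p A, boolSign (σ i)|} :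
        Finset (Fin n → Bool)) ⊆ P.biUnion fun A =>
          {σ | t < |∑ i ∈ A, boolSign (σ i) - ∑ i ∈ p A, boolSign (σ i)|} := by
    intro σ hσ
    simpa using hσ
  have h2 : (#{σ : Fin n → Bool | ∃ A ∈ P,
        t < |∑ i ∈ A, boolSign (σ i) - ∑ i ∈ p A, boolSign (σ i)|} : ℝ) ≤
      ∑ A ∈ P, (#{σ : Fin n → Bool |
        t < |∑ i ∈ A, boolSign (σ i) - ∑ i ∈ p A, boolSign (σ i)|} : ℝ) := by
    exact_mod_cast (card_le_card h1).trans card_biUnion_le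
  refine (h2.trans (sum_le_sum fun A hA =>
    card_lt_abs_sub_boolSign_le A (p A) ht hV (h A hA))).trans ?_
  rw [sum_const, nsmul_eq_mul, mul_left_comm]
  refine mul_le_mul_of_nonneg_left ?_ (by positivity)
  have h3 : (#P : ℝ) ≤ Real.exp c := by
    rcases P.eq_empty_or_nonempty with rfl | h0
    · simp [(Real.exp_pos c).le]
    · rwa [← Real.log_le_iff_le_exp (by exact_mod_cast h0.card_pos)]
  have h4 : (2 : ℝ) ≤ Real.exp 1 := by linarith [Real.add_one_le_exp (1 : ℝ)]
  calc (#P : ℝ) * (2 * Real.exp (-t ^ 2 / (2 * V)))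
      ≤ Real.exp c * (Real.exp 1 * Real.exp (-t ^ 2 / (2 * V))) := by gcongr
    _ = Real.exp (c + 1 - t ^ 2 / (2 * V)) := by
        rw [← Real.exp_add, ← Real.exp_add]; congr 1; ring
    _ ≤ Real.exp b := Real.exp_le_exp.2 hb

theorem log_eight_div_pow_le (j : ℕ) : Real.log (8 / (1 / 4) ^ j) ≤ 5 / 2 * (j + 1) := by
  have h : (8 : ℝ) / (1 / 4) ^ j = 2 ^ (3 + 2 * j) := by
    rw [one_div, inv_pow, div_inv_eq_mul, pow_add, pow_mul]; norm_num
  rw [h, Real.log_pow]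
  push_cast
  nlinarith [Real.log_two_lt_d9, Real.log_two_gt_d9, (Nat.cast_nonneg j : (0 : ℝ) ≤ j)]

/-- Uniform deviation of signed sums over a family of VC dimension at most `d`, by chaining. -/
theorem card_exists_lt_abs_sum_le {n d : ℕ} {𝒜 : Finset (Finset (Fin n))}
    (hd : ∀ s, 𝒜.Shatters s → #s ≤ d) {ε δ : ℝ} (hε : 0 < ε) (hδ : 0 < δ) (hδ' : δ ≤ 1 / 2)
    (h : 4096 * (d + Real.log (1 / δ)) ≤ n * ε ^ 2) :
    (#{σ : Fin n → Bool | ∃ A ∈ 𝒜, n * ε < |∑ i ∈ A, boolSign (σ i)|} : ℝ) ≤ 2 ^ n * δ := by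
  classical
  set l := Real.log (1 / δ) with hl
  have hl2 : Real.log 2 ≤ l :=
    Real.log_le_log (by norm_num) (by rw [le_div_iff₀ hδ]; linarith)
  have hlog2 : 0.69 < Real.log 2 := by linarith [Real.log_two_gt_d9]
  have hδl : δ = Real.exp (-l) := by
    rw [hl, one_div, Real.log_inv, neg_neg, Real.exp_log hδ]
  have hd0 : (0 : ℝ) ≤ d := Nat.cast_nonneg d
  have hn : (0 : ℝ) < n := by
    have : 0 < n * ε ^ 2 := by nlinarith
    exact pos_of_mul_pos_left this (by positivity)
  choose P hPsub hPsep hPnet using fun j : ℕ => exists_separated_net 𝒜 ((1 / 4 : ℝ) ^ j * n)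
  have hlogP : ∀ j : ℕ, Real.log #(P j) ≤ 5 * d * (j + 1) + 1 := fun j => by
    have h1 := log_card_le_of_separated (r := (1 / 4 : ℝ) ^ j) (by positivity)
      (pow_le_one₀ (by norm_num) (by norm_num))
      (fun s hs => hd s (hs.mono_left (hPsub j))) (hPsep j)
    have h2 := mul_le_mul_of_nonneg_left (log_eight_div_pow_le j) hd0
    linarith
  have hnet : ∀ j, ∀ A ∈ 𝒜, ∃ B ∈ P j, (#(symmDiff A B) : ℝ) ≤ (1 / 4 : ℝ) ^ j * n := by
    intro j A hA
    obtain ⟨B, hB, h | rfl⟩ := hPnet j A hA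
    · exact ⟨B, hB, h⟩
    · exact ⟨A, hB, by simp⟩
  choose! p hpP hp using hnet
  obtain ⟨J, hJ⟩ : ∃ J : ℕ, (1 / 4 : ℝ) ^ J < 1 / n :=
    exists_pow_lt_of_lt_one (by positivity) (by norm_num)
  rw [lt_div_iff₀ hn] at hJ
  let t : ℕ → ℝ := fun j => n * ε * (3 / 4) ^ j / 8
  let bad0 : Finset (Fin n → Bool) := {σ | ∃ A ∈ P 0,
    n * ε / 2 < |∑ i ∈ A, boolSign (σ i) - ∑ i ∈ (∅ : Finset (Fin n)), boolSign (σ i)|}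
  let bad : ℕ → Finset (Fin n → Bool) := fun j => {σ | ∃ A ∈ P (j + 1),
    t j < |∑ i ∈ A, boolSign (σ i) - ∑ i ∈ p j A, boolSign (σ i)|}
  have hbad0 : (#bad0 : ℝ) ≤ 2 ^ n * Real.exp (-l - Real.log 2) := by
    refine card_exists_link_le (P 0) (fun _ => ∅) (V := n) (c := 5 * d + 1) (by positivity) hn
      (fun A _ => ?_) ?_ ?_
    · have : #(symmDiff A ∅) ≤ n := (card_le_univ _).trans_eq (Fintype.card_fin n)
      exact Nat.cast_le.2 this
    · simpa using hlogP 0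
    · have : (n * ε / 2) ^ 2 / (2 * (n : ℝ)) = n * ε ^ 2 / 8 := by field_simp; ring
      rw [this]; linarith
  have hbad : ∀ j, (#(bad j) : ℝ) ≤ 2 ^ n * Real.exp (-l - (j + 2 : ℕ) * Real.log 2) := fun j => by
    have hlink := card_exists_link_le (P (j + 1)) (p j) (t := t j) (V := (1 / 4 : ℝ) ^ j * n)
      (c := 5 * d * ((j + 1 : ℕ) + 1) + 1) (b := -l - (j + 2 : ℕ) * Real.log 2) (by positivity)
      (by positivity) (fun A hA => hp j A (hPsub _ hA)) (hlogP (j + 1))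
    refine (le_of_eq (by simp only [bad]; congr!)).trans (hlink ?_)
    have h1 : t j ^ 2 / (2 * ((1 / 4 : ℝ) ^ j * n)) = n * ε ^ 2 * (9 / 4) ^ j / 128 := by
      have h2 : ((3 / 4 : ℝ) ^ j) ^ 2 = (1 / 4) ^ j * (9 / 4) ^ j := by
        rw [← pow_mul, mul_comm, pow_mul, ← mul_pow]; norm_num
      simp only [t]
      rw [div_pow, mul_pow, h2]
      field_simp
      ring
    have h3 : (1 : ℝ) + j ≤ (9 / 4) ^ j := by
      have := one_add_mul_le_pow (a := (5 / 4 : ℝ)) (by norm_num) j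
      norm_num at this
      have h0 : (0 : ℝ) ≤ j := Nat.cast_nonneg j
      linarith
    have h4 : 4096 * (d + l) * (1 + j) ≤ n * ε ^ 2 * (9 / 4) ^ j :=
      mul_le_mul h h3 (by positivity) (by positivity)
    rw [h1]
    push_cast
    have h0 : (0 : ℝ) ≤ j := Nat.cast_nonneg j
    have h5 : 0 ≤ d * (j : ℝ) := by positivity
    have h6 : Real.log 2 * j ≤ l * j := mul_le_mul_of_nonneg_right hl2 h0
    nlinarith
  have hcover : ({σ | ∃ A ∈ 𝒜, n * ε < |∑ i ∈ A, boolSign (σ i)|} : Finset (Fin n → Bool)) ⊆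
      bad0 ∪ (range J).biUnion bad := by
    intro σ hσ
    by_contra hcon
    simp only [bad0, bad, mem_union, mem_filter, mem_univ, true_and, mem_biUnion, not_or,
      not_exists, not_and, not_lt, Finset.mem_range, sum_empty, sub_zero] at hcon
    obtain ⟨hc0, hc⟩ := hcon
    have hchain : ∀ j ≤ J, ∀ A ∈ P j,
        |∑ i ∈ A, boolSign (σ i)| ≤ n * ε * (1 - 1 / 2 * (3 / 4) ^ j) := by
      intro j
      induction j with
      | zero =>
        intro _ A hA
        refine (hc0 A hA).trans (le_of_eq ?_)
        ring
      | succ j ih =>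
        intro hj A hA
        have h1 := ih (by omega) (p j A) (hpP j A (hPsub _ hA))
        have h2 := hc j (by omega) A hA
        have h3 := abs_sub_abs_le_abs_sub (∑ i ∈ A, boolSign (σ i)) (∑ i ∈ p j A, boolSign (σ i))
        simp only [t] at h2
        rw [pow_succ]
        linarith
    simp only [mem_filter, mem_univ, true_and] at hσ
    obtain ⟨A, hA, hlt⟩ := hσ
    have h1 : #(symmDiff A (p J A)) = 0 := by
      have : (#(symmDiff A (p J A)) : ℝ) < 1 := (hp J A hA).trans_lt hJ
      exact Nat.lt_one_iff.1 (by exact_mod_cast this)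
    have h2 : A = p J A := by
      rwa [card_eq_zero, ← bot_eq_empty, symmDiff_eq_bot] at h1
    have h3 := hchain J le_rfl A (h2 ▸ hpP J A hA)
    have : 0 < n * ε * (1 / 2 * (3 / 4 : ℝ) ^ J) := by positivity
    linarith
  have hsum : (#{σ : Fin n → Bool | ∃ A ∈ 𝒜, n * ε < |∑ i ∈ A, boolSign (σ i)|} : ℝ) ≤
      #bad0 + ∑ j ∈ range J, (#(bad j) : ℝ) := by
    exact_mod_cast (card_le_card hcover).trans
      ((card_union_le _ _).trans (Nat.add_le_add_left card_biUnion_le _))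
  have hexp : ∀ k : ℕ, Real.exp (-l - k * Real.log 2) = δ * (1 / 2) ^ k := fun k => by
    rw [sub_eq_add_neg, Real.exp_add, ← hδl, Real.exp_neg, Real.exp_nat_mul,
      Real.exp_log (by norm_num), one_div, inv_pow]
  have h1 := hexp 1
  simp only [Nat.cast_one, one_mul, pow_one] at h1
  rw [h1] at hbad0
  have hgeom : ∀ J : ℕ, ∑ j ∈ range J, (2 : ℝ) ^ n * (δ * (1 / 2) ^ (j + 2)) =
      2 ^ n * (δ * (1 / 2 - (1 / 2) ^ (J + 1))) := fun J => by
    induction J with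
    | zero => simp
    | succ J ih => rw [sum_range_succ, ih]; ring
  have h2 : ∑ j ∈ range J, (#(bad j) : ℝ) ≤ 2 ^ n * (δ * (1 / 2 - (1 / 2) ^ (J + 1))) := by
    rw [← hgeom]
    exact sum_le_sum fun j _ => (hbad j).trans_eq (by rw [hexp])
  have h3 : (0 : ℝ) ≤ 2 ^ n * (δ * (1 / 2) ^ (J + 1)) := by positivity
  linarith

/-! ### Uniform convergence -/

section UniformConvergence

variable {Ω : Type*}

/-- The number of points of the sample `S` that lie in `A`. -/
noncomputable def hits {n : ℕ} (A : Set Ω) (S : Fin n → Ω) : ℝ :=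
  ∑ i, A.indicator (fun _ => (1 : ℝ)) (S i)

theorem card_exists_lt_abs_sum_indicator_le {n d : ℕ} {𝒜 : Set (Set Ω)}
    (hd : ∀ s, SetShatters 𝒜 s → #s ≤ d) {ε δ : ℝ} (hε : 0 < ε) (hδ : 0 < δ) (hδ' : δ ≤ 1 / 2)
    (h : 4096 * (d + Real.log (1 / δ)) ≤ n * ε ^ 2) (S : Fin n → Ω) :
    (Nat.card {σ : Fin n → Bool // ∃ A ∈ 𝒜,
      n * ε < |∑ i, boolSign (σ i) * A.indicator (fun _ => (1 : ℝ)) (S i)|} : ℝ) ≤ 2 ^ n * δ := by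
  classical
  refine le_trans ?_ (card_exists_lt_abs_sum_le (𝒜 := trace 𝒜 S)
    (fun s => card_le_of_trace_shatters hd) hε hδ hδ' h)
  rw [Nat.card_eq_fintype_card, Fintype.card_subtype]
  refine Nat.cast_le.2 (card_le_card fun σ hσ => ?_)
  simp only [mem_filter, mem_univ, true_and] at hσ ⊢
  obtain ⟨A, hA, hlt⟩ := hσ
  refine ⟨univ.filter fun i => S i ∈ A, by simpa [trace] using ⟨A, hA, fun i => Iff.rfl⟩, hlt.trans_eq ?_⟩
  rw [sum_filter]
  congr 1
  refine sum_congr rfl fun i _ => ?_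
  by_cases hi : S i ∈ A <;> simp [hi]

variable [MeasurableSpace Ω]

theorem measurePreserving_comp_equiv {ι ι' : Type*} [Fintype ι] [Fintype ι'] (e : ι ≃ ι')
    (P : Measure Ω) [IsProbabilityMeasure P] :
    MeasurePreserving (fun S : ι' → Ω => S ∘ e) (Measure.pi fun _ => P)
      (Measure.pi fun _ => P) where
  measurable := measurable_pi_lambda _ fun i => measurable_pi_apply (e i)
  map_eq := by
    have hm : Measurable fun S : ι' → Ω => S ∘ e :=
      measurable_pi_lambda _ fun i => measurable_pi_apply (e i)
    refine (Measure.pi_eq fun s hs => ?_).symm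
    rw [Measure.map_apply hm (MeasurableSet.univ_pi hs)]
    have : (fun S : ι' → Ω => S ∘ e) ⁻¹' Set.univ.pi s = Set.univ.pi fun j => s (e.symm j) := by
      ext S
      simp only [Set.mem_preimage, Set.mem_pi, Set.mem_univ, true_imp_iff, Function.comp_apply]
      exact ⟨fun h j => by simpa using h (e.symm j), fun h i => by simpa using h (e i)⟩
    rw [this, Measure.pi_pi, e.symm.prod_comp fun i => P (s i)]

theorem measure_hits_deviation_le {n : ℕ} (P : Measure Ω) [IsProbabilityMeasure P] {A : Set Ω}
    (hA : MeasurableSet A) {ε : ℝ} (hε : 0 < ε) (h : 2 ≤ n * ε ^ 2) :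
    Measure.pi (fun _ : Fin n => P) {S | n * (ε / 2) ≤ |hits A S - n * P.real A|} ≤ 1 / 2 := by
  have hn : (0 : ℝ) < n := by
    have : 0 < n * ε ^ 2 := by linarith
    exact pos_of_mul_pos_left this (by positivity)
  set g : Ω → ℝ := A.indicator fun _ => (1 : ℝ) with hg
  have hgm : Measurable g := measurable_const.indicator hA
  have hg01 : ∀ x, g x ∈ Set.Icc (0 : ℝ) 1 := fun x => by
    by_cases hx : x ∈ A <;> simp [hg, hx]
  have hgL : MemLp g 2 P := MemLp.of_bound hgm.aestronglyMeasurable 1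
    (Filter.Eventually.of_forall fun x => by
      rw [Real.norm_of_nonneg (hg01 x).1]; exact (hg01 x).2)
  have hvar : ProbabilityTheory.variance g P ≤ 1 / 4 := by
    have := ProbabilityTheory.variance_le_sq_of_bounded (μ := P)
      (Filter.Eventually.of_forall hg01) hgm.aemeasurable
    linarith
  have hfun : (hits A : (Fin n → Ω) → ℝ) = ∑ i, fun S : Fin n → Ω => g (S i) := by
    ext S; simp [hits, hg]
  have hL : MemLp (hits A : (Fin n → Ω) → ℝ) 2 (Measure.pi fun _ : Fin n => P) := by
    rw [hfun]
    exact memLp_finsetSum' _ fun i _ => hgL.comp_measurePreserving (measurePreserving_eval _ i)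
  have hmean : ∫ S, hits A S ∂(Measure.pi fun _ : Fin n => P) = n * P.real A := by
    simp only [hits]
    have hint : ∀ i ∈ (univ : Finset (Fin n)),
        Integrable (fun S : Fin n → Ω => g (S i)) (Measure.pi fun _ : Fin n => P) := fun i _ =>
      (hgL.comp_measurePreserving (measurePreserving_eval (fun _ : Fin n => P) i)).integrable
        (by norm_num)
    rw [integral_finsetSum _ hint]
    have : ∀ i : Fin n, ∫ S : Fin n → Ω, g (S i) ∂(Measure.pi fun _ : Fin n => P) = P.real A :=
      fun i => by
        rw [integral_comp_eval (μ := fun _ : Fin n => P) (i := i) hgm.aestronglyMeasurable,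
          hg, integral_indicator_const _ hA]
        simp
    rw [sum_congr rfl fun i _ => this i]
    simp
  have hvarn : ProbabilityTheory.variance (hits A) (Measure.pi fun _ : Fin n => P) ≤ n * (1 / 4) := by
    rw [hfun, ProbabilityTheory.variance_sum_pi (X := fun _ => g) fun _ => hgL]
    rw [sum_const, card_univ, Fintype.card_fin, nsmul_eq_mul]
    exact mul_le_mul_of_nonneg_left hvar hn.le
  have hcheb := ProbabilityTheory.meas_ge_le_variance_div_sq hL
    (c := n * (ε / 2)) (by positivity)
  rw [hmean] at hcheb
  refine hcheb.trans ?_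
  rw [show (1 / 2 : ℝ≥0∞) = ENNReal.ofReal (1 / 2) by
    rw [ENNReal.ofReal_div_of_pos (by norm_num)]; simp]
  refine ENNReal.ofReal_le_ofReal ?_
  rw [div_le_iff₀ (by positivity)]
  refine hvarn.trans ?_
  nlinarith

/-- The pairs of samples on which the frequencies of some member of `𝒜` differ. -/
def twoSampleDeviation (𝒜 : Set (Set Ω)) (n : ℕ) (ε : ℝ) : Set ((Fin n → Ω) × (Fin n → Ω)) :=
  {q | ∃ A ∈ 𝒜, n * ε < |hits A q.1 - hits A q.2|}

/-- Symmetrization by a ghost sample. -/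
theorem measure_deviation_le_twoSampleDeviation {n : ℕ} (P : Measure Ω) [IsProbabilityMeasure P]
    {𝒜 : Set (Set Ω)} (h𝒜 : ∀ A ∈ 𝒜, MeasurableSet A) {ε : ℝ} (hε : 0 < ε)
    (h : 2 ≤ n * ε ^ 2) :
    Measure.pi (fun _ : Fin n => P) {S | ∃ A ∈ 𝒜, n * ε < |hits A S - n * P.real A|} ≤
      2 * ((Measure.pi fun _ : Fin n => P).prod (Measure.pi fun _ : Fin n => P))
        (twoSampleDeviation 𝒜 n (ε / 2)) := by
  set μ := Measure.pi fun _ : Fin n => P with hμ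
  set B := toMeasurable (μ.prod μ) (twoSampleDeviation 𝒜 n (ε / 2)) with hB
  have hBm : MeasurableSet B := measurableSet_toMeasurable _ _
  rw [← measure_toMeasurable (μ := μ.prod μ) (twoSampleDeviation 𝒜 n (ε / 2)), ← hB,
    Measure.prod_apply hBm]
  have hsub : {S | ∃ A ∈ 𝒜, n * ε < |hits A S - n * P.real A|} ⊆
      {S | 1 / 2 ≤ μ (Prod.mk S ⁻¹' B)} := by
    rintro S ⟨A, hA, hS⟩
    set G : Set (Fin n → Ω) := {S' | n * (ε / 2) ≤ |hits A S' - n * P.real A|} with hG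
    have hGm : MeasurableSet G := by
      refine measurableSet_le measurable_const ?_
      refine ((Finset.measurable_sum _ fun i _ => ?_).sub_const _).abs
      exact (measurable_const.indicator (h𝒜 A hA)).comp (measurable_pi_apply i)
    have h1 : μ G ≤ 1 / 2 := measure_hits_deviation_le P (h𝒜 A hA) hε h
    have h2 : 1 / 2 ≤ μ Gᶜ := by
      rw [prob_compl_eq_one_sub hGm]
      refine le_trans ?_ (tsub_le_tsub_left h1 1)
      rw [one_div, ENNReal.one_sub_inv_two]
    refine h2.trans (measure_mono fun S' hS' => ?_)
    refine subset_toMeasurable _ _ ⟨A, hA, ?_⟩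
    simp only [hG, Set.mem_compl_iff, Set.mem_ofPred_eq, not_le] at hS'
    have h3 := abs_sub_abs_le_abs_sub (hits A S - n * P.real A) (hits A S' - n * P.real A)
    simp only [sub_sub_sub_cancel_right] at h3
    change _ < |hits A S - hits A S'|
    linarith
  have h4 := mul_meas_ge_le_lintegral (μ := μ) (measurable_measure_prodMk_left (ν := μ) hBm) (1 / 2)
  calc μ {S | ∃ A ∈ 𝒜, n * ε < |hits A S - n * P.real A|}
      ≤ μ {S | 1 / 2 ≤ μ (Prod.mk S ⁻¹' B)} := measure_mono hsub
    _ = 2 * (1 / 2 * μ {S | 1 / 2 ≤ μ (Prod.mk S ⁻¹' B)}) := by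
        rw [← mul_assoc, one_div, ENNReal.mul_inv_cancel (by norm_num) (by norm_num), one_mul]
    _ ≤ _ := mul_le_mul_right h4 2

/-- The permutation of the double sample that exchanges the pairs marked by `σ`. -/
def swapPairs {n : ℕ} (σ : Fin n → Bool) : Fin n ⊕ Fin n ≃ Fin n ⊕ Fin n where
  toFun := Sum.elim (fun i => if σ i then Sum.inl i else Sum.inr i)
    (fun i => if σ i then Sum.inr i else Sum.inl i)
  invFun := Sum.elim (fun i => if σ i then Sum.inl i else Sum.inr i)
    (fun i => if σ i then Sum.inr i else Sum.inl i)
  left_inv := by rintro (i | i) <;> by_cases h : σ i <;> simp [h]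
  right_inv := by rintro (i | i) <;> by_cases h : σ i <;> simp [h]

theorem nullMeasurableSet_doubleSampleDeviation {n : ℕ} (P : Measure Ω) [IsProbabilityMeasure P]
    {𝒜 : Set (Set Ω)}
    (hsup : ∀ e : Fin (n + n) → ℝ, AEMeasurable (fun S : Fin (n + n) → Ω =>
      ⨆ A : 𝒜, |∑ i, e i * A.1.indicator (fun _ => (1 : ℝ)) (S i)|) (Measure.pi fun _ => P))
    {t : ℝ} (ht : 0 ≤ t) :
    NullMeasurableSet {S : Fin n ⊕ Fin n → Ω |
      ∃ A ∈ 𝒜, t < |hits A (S ∘ Sum.inl) - hits A (S ∘ Sum.inr)|} (Measure.pi fun _ => P) := by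
  have h1 := (hsup fun i => Sum.elim (fun _ => 1) (fun _ => -1) (finSumFinEquiv.symm i))
    |>.nullMeasurable (measurableSet_Ioi (a := t))
  have h2 := h1.preimage
    (measurePreserving_comp_equiv finSumFinEquiv.symm P).quasiMeasurePreserving
  refine (congrArg (NullMeasurableSet · (Measure.pi fun _ => P)) ?_).mpr h2
  ext S
  have h3 : ∀ A : Set Ω, ∑ i, Sum.elim (fun _ => (1 : ℝ)) (fun _ => -1)
      ((finSumFinEquiv (m := n) (n := n)).symm i) *
        A.indicator (fun _ => (1 : ℝ)) ((S ∘ finSumFinEquiv.symm) i) =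
      hits A (S ∘ Sum.inl) - hits A (S ∘ Sum.inr) := fun A => by
    rw [← finSumFinEquiv.sum_comp, Fintype.sum_sum_type]
    simp only [Function.comp_apply, Equiv.symm_apply_apply, Sum.elim_inl, Sum.elim_inr, hits]
    simp [sub_eq_add_neg]
  simp only [Set.mem_ofPred_eq, Set.mem_preimage, Set.mem_Ioi, h3]
  have hbdd : BddAbove (Set.range fun A : 𝒜 =>
      |hits A.1 (S ∘ Sum.inl) - hits A.1 (S ∘ Sum.inr)|) := by
    refine ⟨n + n, ?_⟩
    rintro _ ⟨A, rfl⟩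
    have h4 : ∀ T : Fin n → Ω, |hits A.1 T| ≤ n := fun T => by
      refine (abs_sum_le_sum_abs _ _).trans ((sum_le_sum (g := fun _ => (1 : ℝ)) fun i _ => ?_).trans
        (by simp))
      by_cases hi : T i ∈ A.1 <;> simp [hi]
    exact (abs_sub _ _).trans (add_le_add (h4 _) (h4 _))
  constructor
  · rintro ⟨A, hA, h⟩
    exact h.trans_le (le_ciSup hbdd ⟨A, hA⟩)
  · intro h
    rcases isEmpty_or_nonempty 𝒜 with hE | hE
    · rw [Real.iSup_of_isEmpty] at h
      exact absurd h (not_lt.2 ht)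
    · obtain ⟨A, hA⟩ := exists_lt_of_lt_ciSup h
      exact ⟨A.1, A.2, hA⟩

theorem measure_twoSampleDeviation_le {n : ℕ} (P : Measure Ω) [IsProbabilityMeasure P]
    {𝒜 : Set (Set Ω)} {ε δ : ℝ}
    (hnull : NullMeasurableSet {S : Fin n ⊕ Fin n → Ω |
      ∃ A ∈ 𝒜, n * ε < |hits A (S ∘ Sum.inl) - hits A (S ∘ Sum.inr)|} (Measure.pi fun _ => P))
    (hcard : ∀ S S' : Fin n → Ω, (Nat.card {σ : Fin n → Bool // ∃ A ∈ 𝒜,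
      n * ε < |∑ i, boolSign (σ i) * (A.indicator (fun _ => (1 : ℝ)) (S i) -
        A.indicator (fun _ => (1 : ℝ)) (S' i))|} : ℝ) ≤ 2 ^ n * δ) :
    ((Measure.pi fun _ : Fin n => P).prod (Measure.pi fun _ : Fin n => P))
        (twoSampleDeviation 𝒜 n ε) ≤ ENNReal.ofReal δ := by
  classical
  set ν := Measure.pi fun _ : Fin n ⊕ Fin n => P with hν
  set B : Set (Fin n ⊕ Fin n → Ω) := {S |
      ∃ A ∈ 𝒜, n * ε < |hits A (S ∘ Sum.inl) - hits A (S ∘ Sum.inr)|} with hB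
  have h0 : ((Measure.pi fun _ : Fin n => P).prod (Measure.pi fun _ : Fin n => P))
        (twoSampleDeviation 𝒜 n ε) = ν B :=
    ((measurePreserving_sumPiEquivProdPi (X := fun _ : Fin n ⊕ Fin n => Ω)
      fun _ => P).measure_preimage_equiv (twoSampleDeviation 𝒜 n ε)).symm
  rw [h0]
  have hmp : ∀ σ : Fin n → Bool, MeasurePreserving (fun S => S ∘ swapPairs σ) ν ν := fun σ =>
    measurePreserving_comp_equiv _ P
  have h1 : ∀ σ : Fin n → Bool, ∫⁻ S, ((fun S => S ∘ swapPairs σ) ⁻¹' B).indicator 1 S ∂ν = ν B :=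
    fun σ => by
      rw [lintegral_indicator_one₀ (hnull.preimage (hmp σ).quasiMeasurePreserving),
        (hmp σ).measure_preimage hnull]
  have h2 : ∀ (σ : Fin n → Bool) (S : Fin n ⊕ Fin n → Ω), S ∘ swapPairs σ ∈ B ↔ ∃ A ∈ 𝒜,
      n * ε < |∑ i, boolSign (σ i) * (A.indicator (fun _ => (1 : ℝ)) (S (.inl i)) -
        A.indicator (fun _ => (1 : ℝ)) (S (.inr i)))| := fun σ S => by
    refine exists_congr fun A => and_congr_right fun _ => ?_
    have : hits A ((S ∘ swapPairs σ) ∘ Sum.inl) - hits A ((S ∘ swapPairs σ) ∘ Sum.inr) =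
        ∑ i, boolSign (σ i) * (A.indicator (fun _ => (1 : ℝ)) (S (.inl i)) -
          A.indicator (fun _ => (1 : ℝ)) (S (.inr i))) := by
      simp only [hits]
      rw [← sum_sub_distrib]
      refine sum_congr rfl fun i _ => ?_
      by_cases h : σ i <;> simp [swapPairs, boolSign, h]
    rw [this]
  have h3 : ∀ S, ∑ σ : Fin n → Bool, ((fun S => S ∘ swapPairs σ) ⁻¹' B).indicator
      (1 : (Fin n ⊕ Fin n → Ω) → ℝ≥0∞) S ≤ ENNReal.ofReal (2 ^ n * δ) := fun S => by
    have h4 := hcard (S ∘ Sum.inl) (S ∘ Sum.inr)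
    rw [Nat.card_eq_fintype_card, Fintype.card_subtype] at h4
    have h5 : ∑ σ : Fin n → Bool, ((fun S => S ∘ swapPairs σ) ⁻¹' B).indicator
      (1 : (Fin n ⊕ Fin n → Ω) → ℝ≥0∞) S = (#{σ : Fin n → Bool | S ∘ swapPairs σ ∈ B} : ℝ≥0∞) := by
      rw [card_filter]
      push_cast
      exact sum_congr rfl fun σ _ => by simp [Set.indicator_apply]
    rw [h5, ← ENNReal.ofReal_natCast]
    refine ENNReal.ofReal_le_ofReal (le_trans (le_of_eq ?_) h4)
    congr 2
    ext σ
    simp only [mem_filter, mem_univ, true_and]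
    exact h2 σ S
  have h6 : (2 : ℝ≥0∞) ^ n * ν B ≤ 2 ^ n * ENNReal.ofReal δ := by
    calc (2 : ℝ≥0∞) ^ n * ν B = ∑ σ : Fin n → Bool, ν B := by simp
      _ = ∑ σ : Fin n → Bool, ∫⁻ S, ((fun S => S ∘ swapPairs σ) ⁻¹' B).indicator 1 S ∂ν :=
          sum_congr rfl fun σ _ => (h1 σ).symm
      _ = ∫⁻ S, ∑ σ : Fin n → Bool, ((fun S => S ∘ swapPairs σ) ⁻¹' B).indicator 1 S ∂ν := by
          refine (lintegral_finsetSum' _ fun σ _ => ?_).symm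
          exact aemeasurable_one.indicator₀ (hnull.preimage (hmp σ).quasiMeasurePreserving)
      _ ≤ ∫⁻ _, ENNReal.ofReal (2 ^ n * δ) ∂ν := lintegral_mono h3
      _ = 2 ^ n * ENNReal.ofReal δ := by
          rw [lintegral_const, measure_univ, mul_one, ENNReal.ofReal_mul (by positivity)]
          simp [ENNReal.ofReal_pow]
  rwa [ENNReal.mul_le_mul_iff_right (by positivity) (by simp)] at h6

/-- Uniform convergence of frequencies to probabilities over a class of finite VC dimension, with
the optimal dependence of the sample size on the accuracy. -/
theorem measure_exists_deviation_le {n d : ℕ} (P : Measure Ω) [IsProbabilityMeasure P]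
    {𝒜 : Set (Set Ω)} (h𝒜 : ∀ A ∈ 𝒜, MeasurableSet A) (hd : ∀ s, SetShatters 𝒜 s → #s ≤ d)
    (hsup : ∀ e : Fin (n + n) → ℝ, AEMeasurable (fun S : Fin (n + n) → Ω =>
      ⨆ A : 𝒜, |∑ i, e i * A.1.indicator (fun _ => (1 : ℝ)) (S i)|) (Measure.pi fun _ => P))
    {ε δ : ℝ} (hε : 0 < ε) (hδ : 0 < δ) (hδ' : δ ≤ 1 / 2)
    (h : 196608 * (d + Real.log (1 / δ)) ≤ n * ε ^ 2) :
    Measure.pi (fun _ : Fin n => P) {S | ∃ A ∈ 𝒜, n * ε < |hits A S - n * P.real A|} ≤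
      ENNReal.ofReal δ := by
  have hl2 : Real.log 2 ≤ Real.log (1 / δ) :=
    Real.log_le_log (by norm_num) (by rw [le_div_iff₀ hδ]; linarith)
  have hlog2 : 0.69 < Real.log 2 := by linarith [Real.log_two_gt_d9]
  have hd0 : (0 : ℝ) ≤ d := Nat.cast_nonneg d
  have hl4 : Real.log (1 / (δ / 4)) = Real.log (1 / δ) + 2 * Real.log 2 := by
    rw [show 1 / (δ / 4) = 1 / δ * 2 ^ 2 by field_simp; norm_num,
      Real.log_mul (by positivity) (by positivity), Real.log_pow]
    norm_num
  have h1 := measure_deviation_le_twoSampleDeviation P h𝒜 hε (n := n) (by linarith)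
  have h2 := measure_twoSampleDeviation_le P (ε := ε / 2) (δ := δ / 2)
    (nullMeasurableSet_doubleSampleDeviation P hsup (by positivity)) fun S S' => ?_
  · refine h1.trans ((mul_le_mul_right h2 2).trans (le_of_eq ?_))
    rw [show (2 : ℝ≥0∞) = ENNReal.ofReal 2 by simp, ← ENNReal.ofReal_mul (by norm_num)]
    congr 1; ring
  · have h3 := card_exists_lt_abs_sum_indicator_le hd (ε := ε / 4) (δ := δ / 4) (n := n)
      (by positivity) (by positivity) (by linarith) (by rw [hl4]; nlinarith)
    have h4 := h3 S
    have h5 := h3 S'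
    classical
    rw [Nat.card_eq_fintype_card, Fintype.card_subtype] at h4 h5 ⊢
    have h6 : ({σ | ∃ A ∈ 𝒜, n * (ε / 2) < |∑ i, boolSign (σ i) *
        (A.indicator (fun _ => (1 : ℝ)) (S i) - A.indicator (fun _ => (1 : ℝ)) (S' i))|} :
        Finset (Fin n → Bool)) ⊆
        ({σ | ∃ A ∈ 𝒜, n * (ε / 4) < |∑ i, boolSign (σ i) *
          A.indicator (fun _ => (1 : ℝ)) (S i)|} : Finset (Fin n → Bool)) ∪
        ({σ | ∃ A ∈ 𝒜, n * (ε / 4) < |∑ i, boolSign (σ i) *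
          A.indicator (fun _ => (1 : ℝ)) (S' i)|} : Finset (Fin n → Bool)) := by
      intro σ hσ
      simp only [mem_filter, mem_univ, true_and, mem_union] at hσ ⊢
      obtain ⟨A, hA, hlt⟩ := hσ
      by_contra! hcon
      have h7 := hcon.1 A hA
      have h8 := hcon.2 A hA
      simp only [mul_sub, sum_sub_distrib] at hlt
      have h9 := abs_sub (∑ i, boolSign (σ i) * A.indicator (fun _ => (1 : ℝ)) (S i))
        (∑ i, boolSign (σ i) * A.indicator (fun _ => (1 : ℝ)) (S' i))
      linarith
    have h10 := Nat.cast_le (α := ℝ).2 ((card_le_card h6).trans (card_union_le _ _))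
    push_cast at h10
    linarith

end UniformConvergence

/-! ### Loss classes -/

/-- The labelled examples on which `f` errs. -/
def errorSet {X : Type*} (f : X → Bool) : Set (X × Bool) := {p | f p.1 ≠ p.2}

theorem card_le_vcDim_of_setShatters {X : Type u} {𝒞 : Set (X → Bool)} {s : Finset (X × Bool)}
    (h : SetShatters (errorSet '' 𝒞) s) : (#s : ℕ∞) ≤ vcDim 𝒞 := by
  classical
  have hinj : Set.InjOn Prod.fst (s : Set (X × Bool)) := by
    rintro ⟨x, b⟩ hx ⟨x', b'⟩ hy rfl
    obtain ⟨_, ⟨f, -, rfl⟩, hf⟩ := h ∅ (empty_subset _)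
    have h1 := hf _ hx
    have h2 := hf _ hy
    simp only [errorSet, Set.mem_ofPred_eq, notMem_empty, iff_false, not_not, ne_eq] at h1 h2
    rw [← h1, ← h2]
  rw [← card_image_of_injOn hinj]
  refine le_iSup₂_of_le (s.image Prod.fst) (fun g => ?_) le_rfl
  obtain ⟨_, ⟨f, hf, rfl⟩, hfs⟩ := h {p ∈ s | g p.1 ≠ p.2} (filter_subset _ _)
  refine ⟨f, hf, fun x hx => ?_⟩
  obtain ⟨p, hp, rfl⟩ := mem_image.1 hx
  have := hfs p hp
  simp only [errorSet, Set.mem_ofPred_eq, mem_filter, hp, true_and] at this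
  revert this
  cases f p.1 <;> cases g p.1 <;> cases p.2 <;> simp

theorem loss_eq_indicator {X : Type u} (f : X → Bool) (p : X × Bool) :
    loss f p = (errorSet f).indicator (fun _ => (1 : ℝ)) p := by
  by_cases h : f p.1 = p.2 <;> simp [loss, errorSet, h]

theorem hits_errorSet {X : Type u} {n : ℕ} (hn : 0 < n) (f : X → Bool) (S : Fin n → X × Bool) :
    hits (errorSet f) S = n * empErr f S := by
  have : (n : ℝ) ≠ 0 := by positivity
  simp only [hits, empErr, loss_eq_indicator]
  field_simp

theorem empErr_nonneg {X : Type u} {n : ℕ} (f : X → Bool) (S : Fin n → X × Bool) :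
    0 ≤ empErr f S :=
  div_nonneg (sum_nonneg fun i _ => by unfold loss; split_ifs <;> norm_num) (Nat.cast_nonneg n)

theorem empErr_le_one {X : Type u} {n : ℕ} (f : X → Bool) (S : Fin n → X × Bool) :
    empErr f S ≤ 1 := by
  refine div_le_one_of_le₀ ?_ (Nat.cast_nonneg n)
  refine (sum_le_sum (g := fun _ => (1 : ℝ)) fun i _ => ?_).trans (by simp)
  unfold loss; split_ifs <;> norm_num

/-! ### Finitely supported laws -/

theorem iid_apply {α : Type u} (p : PMF α) : ∀ (k : ℕ) (f : Fin k → α), iid p k f = ∏ i, p (f i)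
  | 0, f => by simp [iid, Subsingleton.elim f Fin.elim0]
  | k + 1, f => by
    classical
    have h1 : ∀ a as, (PMF.pure (Fin.cons a as : Fin (k + 1) → α)) f =
        (if a = f 0 then 1 else 0) * (if as = Fin.tail f then 1 else 0) := fun a as => by
      rw [PMF.pure_apply]
      by_cases ha : a = f 0
      · by_cases has : as = Fin.tail f
        · subst ha has; simp
        · have : f ≠ Fin.cons a as := fun h => has (by rw [h, Fin.tail_cons])
          simp [has, this]
      · have : f ≠ Fin.cons a as := fun h => ha (by rw [h, Fin.cons_zero])
        simp [ha, this]
    simp only [iid, PMF.bind_apply, h1]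
    rw [tsum_eq_single (f 0), tsum_eq_single (Fin.tail f)]
    · simp [iid_apply p k, Fin.prod_univ_succ, Fin.tail]
    · intro as has; simp [has]
    · intro a ha; simp [ha]

theorem iid_map {α β : Type u} (p : PMF α) (φ : α → β) :
    ∀ k : ℕ, iid (p.map φ) k = (iid p k).map fun S => φ ∘ S
  | 0 => by
    simp only [iid, PMF.pure_map]
    congr 1
    exact Subsingleton.elim _ _
  | k + 1 => by
    simp only [iid, PMF.bind_map, PMF.map_bind, iid_map p φ k, PMF.pure_map, Function.comp_def]
    congr; ext1 a; congr; ext1 S; congr 1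
    ext i
    refine Fin.cases ?_ (fun j => ?_) i <;> simp

theorem iid_exists_deviation_le {Ω : Type u} [Finite Ω] (p : PMF Ω) {n d : ℕ}
    {𝒜 : Set (Set Ω)} (hd : ∀ s, SetShatters 𝒜 s → #s ≤ d) {ε δ : ℝ} (hε : 0 < ε) (hδ : 0 < δ)
    (hδ' : δ ≤ 1 / 2) (h : 196608 * (d + Real.log (1 / δ)) ≤ n * ε ^ 2) :
    (iid p n).toOuterMeasure {S | ∃ A ∈ 𝒜, n * ε < |hits A S - n * (p.toOuterMeasure A).toReal|} ≤
      ENNReal.ofReal δ := by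
  let _ : MeasurableSpace Ω := ⊤
  have : DiscreteMeasurableSpace Ω := ⟨fun _ => trivial⟩
  have hpi : (iid p n).toMeasure = Measure.pi fun _ : Fin n => p.toMeasure := by
    refine Measure.ext_of_singleton fun f => ?_
    rw [PMF.toMeasure_apply_singleton _ _ (measurableSet_singleton f), Measure.pi_singleton,
      iid_apply]
    exact prod_congr rfl fun i _ =>
      (PMF.toMeasure_apply_singleton _ _ (measurableSet_singleton _)).symm
  have := measure_exists_deviation_le (n := n) p.toMeasure (𝒜 := 𝒜)
    (fun A _ => MeasurableSet.of_discrete) hd (fun e => (Measurable.of_discrete).aemeasurable)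
    hε hδ hδ' h
  rw [← hpi, PMF.toMeasure_apply_eq_toOuterMeasure] at this
  simpa only [Measure.real, PMF.toMeasure_apply_eq_toOuterMeasure] using this

/-! ### The oracle on the mixture -/

section Mixture

variable {X : Type u} {𝒯 : Finset (X → X)} {m : ℕ}

/-- The error of `h` on the mixture of the transformed datasets `T(S)` with weights `Q`. -/
noncomputable def mixErr (S : Fin m → X × Bool) (Q : PMF 𝒯) (h : X → Bool) : ℝ :=
  ∑ T : 𝒯, (Q T).toReal * empErr h (transform T.1 S)

/-- The law of a transformation drawn from `Q` and, independently, a uniform index. -/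
noncomputable def indexLaw (m : ℕ) [NeZero m] (Q : PMF 𝒯) : PMF (𝒯 × Fin m) :=
  Q.bind fun T => (PMF.uniformOfFintype (Fin m)).map fun i => (T, i)

theorem indexLaw_apply [NeZero m] (Q : PMF 𝒯) (T : 𝒯) (i : Fin m) :
    indexLaw m Q (T, i) = Q T * (m : ℝ≥0∞)⁻¹ := by
  classical
  rw [indexLaw, PMF.bind_apply, tsum_eq_single T]
  · rw [PMF.map_apply, tsum_eq_single i]
    · simp
    · intro j hj; simp [hj.symm]
  · intro T' hT'
    rw [PMF.map_apply]
    simp [hT'.symm]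

theorem mixture_eq_map [NeZero m] (S : Fin m → X × Bool) (Q : PMF 𝒯) :
    mixture S Q = (indexLaw m Q).map fun ω => transform ω.1.1 S ω.2 := by
  simp only [mixture, indexLaw, PMF.map_bind, PMF.map_comp, Function.comp_def]

theorem indexLaw_toOuterMeasure_errorSet [NeZero m] (S : Fin m → X × Bool) (Q : PMF 𝒯)
    (h : X → Bool) :
    ((indexLaw m Q).toOuterMeasure
      ((fun ω : 𝒯 × Fin m => transform ω.1.1 S ω.2) ⁻¹' errorSet h)).toReal = mixErr S Q h := by
  classical
  rw [PMF.toOuterMeasure_apply_fintype, ENNReal.toReal_sum, Fintype.sum_prod_type, mixErr]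
  · refine sum_congr rfl fun T _ => ?_
    rw [empErr, sum_div, mul_sum]
    refine sum_congr rfl fun i _ => ?_
    by_cases hi : transform T.1 S i ∈ errorSet h
    · rw [Set.indicator_of_mem (by exact hi), indexLaw_apply, loss_eq_indicator,
        Set.indicator_of_mem hi]
      simp
    · rw [Set.indicator_of_notMem (by exact hi), loss_eq_indicator, Set.indicator_of_notMem hi]
      simp
  · intro ω _
    exact ne_top_of_le_ne_top ((indexLaw m Q).apply_ne_top ω) (Set.indicator_le_self _ _ _)

theorem card_le_of_setShatters_preimageClass (S : Fin m → X × Bool) {H : Set (X → Bool)}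
    {s : Finset (𝒯 × Fin m)}
    (hs : SetShatters (preimageClass (fun ω : 𝒯 × Fin m => transform ω.1.1 S ω.2)
      (errorSet '' H)) s) :
    #s ≤ (min (vcDim H) ((m * 𝒯.card : ℕ) : ℕ∞)).toNat := by
  have h1 : (#s : ℕ∞) ≤ ((m * 𝒯.card : ℕ) : ℕ∞) := by
    refine Nat.cast_le.2 ((card_le_univ s).trans_eq ?_)
    simp [mul_comm]
  have h2 : (#s : ℕ∞) ≤ vcDim H := by
    rcases eq_or_ne (vcDim H) ⊤ with h | h
    · rw [h]; exact le_top
    · obtain ⟨d, hd⟩ := ENat.ne_top_iff_exists.1 h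
      rw [← hd]
      refine Nat.cast_le.2 (SetShatters.card_le_of_preimageClass (fun t ht => ?_) hs)
      have := card_le_vcDim_of_setShatters ht
      rw [← hd] at this
      exact Nat.cast_le.1 this
  have h3 := ENat.toNat_le_toNat (le_min h2 h1)
    (ne_top_of_le_ne_top (ENat.natCast_ne_top _) (min_le_right _ _))
  simpa using h3

/-- On `k` draws from the mixture, the oracle is nearly optimal for the mixture. -/
theorem iid_mixture_erm_le [NeZero m] {H : Set (X → Bool)} {erm : Learner X} (herm : IsERM H erm)
    (S : Fin m → X × Bool) (Q : PMF 𝒯) {k : ℕ} {ε β : ℝ} (hε : 0 < ε) (hβ : 0 < β)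
    (hβ' : β ≤ 1 / 2)
    (hk : 196608 * ((min (vcDim H) ((m * 𝒯.card : ℕ) : ℕ∞)).toNat + Real.log (1 / β))
      ≤ k * ε ^ 2) :
    (iid (mixture S Q) k).toOuterMeasure
      {s | ∃ h ∈ H, mixErr S Q h + 2 * ε < mixErr S Q (erm k s)} ≤ ENNReal.ofReal β := by
  have hk0 : 0 < k := by
    have h1 : 0 < Real.log (1 / β) := Real.log_pos (by rw [lt_div_iff₀ hβ]; linarith)
    have h2 : 0 < k * ε ^ 2 := lt_of_lt_of_le (by positivity) hk
    exact_mod_cast pos_of_mul_pos_left h2 (by positivity)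
  have hkr : (0 : ℝ) < k := by exact_mod_cast hk0
  rw [mixture_eq_map, iid_map, PMF.toOuterMeasure_map_apply]
  refine ((iid (indexLaw m Q) k).toOuterMeasure.mono ?_).trans
    (iid_exists_deviation_le (indexLaw m Q)
      (fun s hs => card_le_of_setShatters_preimageClass (H := H) S hs) hε hβ hβ' hk)
  rintro s ⟨h, hh, hlt⟩
  by_contra hcon
  simp only [Set.mem_ofPred_eq, not_exists, not_and, not_lt] at hcon
  set ψ : 𝒯 × Fin m → X × Bool := fun ω => transform ω.1.1 S ω.2 with hψ
  have hdev : ∀ f ∈ H, |k * empErr f (ψ ∘ s) - k * mixErr S Q f| ≤ k * ε := fun f hf => by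
    have := hcon _ ⟨_, ⟨f, hf, rfl⟩, rfl⟩
    rw [indexLaw_toOuterMeasure_errorSet] at this
    rw [← hits_errorSet hk0]
    exact this
  obtain ⟨hermH, hmin⟩ := herm k (ψ ∘ s)
  have h1 := (abs_le.1 (hdev _ hermH)).1
  have h2 := (abs_le.1 (hdev _ hh)).2
  have h3 := mul_le_mul_of_nonneg_left (hmin h hh) hkr.le
  have h4 := mul_lt_mul_of_pos_left hlt hkr
  simp only [Function.comp_def] at h1 h2 h3 h4
  linarith

end Mixture

/-! ### Multiplicative weights -/

section MultiplicativeWeights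

variable {X : Type u} {𝒯 : Finset (X → X)} {m : ℕ}

theorem exp_le_one_add_add_sq {x : ℝ} (h0 : 0 ≤ x) (h1 : x ≤ 1 / 2) :
    Real.exp x ≤ 1 + x + 5 / 8 * x ^ 2 := by
  have h := Real.exp_bound' h0 (h1.trans (by norm_num)) (n := 3) (by norm_num)
  simp only [sum_range_succ, range_zero, sum_empty, Nat.factorial] at h
  norm_num at h
  nlinarith [mul_nonneg (sq_nonneg x) (sub_nonneg.2 h1), sq_nonneg x]

theorem sum_toReal_eq_one {α : Type*} [Fintype α] (Q : PMF α) : ∑ a, (Q a).toReal = 1 := by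
  have h := Q.tsum_coe
  rw [tsum_fintype] at h
  rw [← ENNReal.toReal_sum fun a _ => Q.apply_ne_top a, h, ENNReal.toReal_one]

theorem mwUpdate_toReal (η : ℝ) (gain : 𝒯 → ℝ) (Q : PMF 𝒯) (T : 𝒯) :
    (mwUpdate η gain Q T).toReal = (Q T).toReal * Real.exp (η * gain T) /
      ∑ T', (Q T').toReal * Real.exp (η * gain T') := by
  have h : ∀ T, (mwWeight η gain Q T).toReal = (Q T).toReal * Real.exp (η * gain T) := fun T => by
    rw [mwWeight, ENNReal.toReal_mul, ENNReal.toReal_ofReal (Real.exp_pos _).le]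
  have htop : ∀ T ∈ (univ : Finset 𝒯), mwWeight η gain Q T ≠ ∞ := fun T _ =>
    ENNReal.mul_ne_top (Q.apply_ne_top T) ENNReal.ofReal_ne_top
  rw [mwUpdate, PMF.normalize_apply, ENNReal.toReal_mul, ENNReal.toReal_inv, tsum_fintype,
    ENNReal.toReal_sum htop, h, div_eq_mul_inv]
  simp only [h]

theorem sum_mul_exp_le {α : Type*} [Fintype α] {q g : α → ℝ} (hq : ∀ a, 0 ≤ q a)
    (hq1 : ∑ a, q a = 1) (hg0 : ∀ a, 0 ≤ g a) (hg1 : ∀ a, g a ≤ 1) {η v : ℝ} (hη : 0 ≤ η)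
    (hη' : η ≤ 1 / 2) (hv : ∑ a, q a * g a ≤ v) :
    ∑ a, q a * Real.exp (η * g a) ≤ Real.exp (η * v + 5 / 8 * η ^ 2) := by
  have h1 : ∀ a ∈ univ, q a * Real.exp (η * g a) ≤
      q a + η * (q a * g a) + q a * (5 / 8 * η ^ 2) := fun a _ => by
    have h2 : η * g a ≤ η := mul_le_of_le_one_right hη (hg1 a)
    have h3 := exp_le_one_add_add_sq (mul_nonneg hη (hg0 a)) (h2.trans hη')
    have h4 : (η * g a) ^ 2 ≤ η ^ 2 := pow_le_pow_left₀ (mul_nonneg hη (hg0 a)) h2 2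
    have h5 := mul_le_mul_of_nonneg_left
      (show Real.exp (η * g a) ≤ 1 + η * g a + 5 / 8 * η ^ 2 by linarith) (hq a)
    linarith
  refine (sum_le_sum h1).trans ?_
  rw [sum_add_distrib, sum_add_distrib, ← mul_sum, ← sum_mul, hq1]
  have h6 := mul_le_mul_of_nonneg_left hv hη
  linarith [Real.add_one_le_exp (η * v + 5 / 8 * η ^ 2)]

/-- The cumulative empirical regret of the predictors `h` on `T(S)`. -/
noncomputable def totalRegret (erm : Learner X) (S : Fin m → X × Bool) {n : ℕ}
    (h : Fin n → X → Bool) (T : X → X) : ℝ :=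
  ∑ r, empRegret erm S (h r) T

/-- The state reached after `n` rounds in each of which the predictor found had regret at most `v`
on the mixture: the current distribution is given by the exponential weights, whose sum is
bounded. The last clause covers the step size `0`, which occurs if there is only one
transformation. -/
structure GoodState (H : Set (X → Bool)) (erm : Learner X) (S : Fin m → X × Bool) (η v : ℝ)
    (n : ℕ) (st : (Fin n → X → Bool) × PMF 𝒯) : Prop where
  mem : ∀ r, st.1 r ∈ H
  weight : ∀ T : 𝒯, (st.2 T).toReal = Real.exp (η * totalRegret erm S st.1 T.1) /
    ∑ T' : 𝒯, Real.exp (η * totalRegret erm S st.1 T'.1)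
  sum_le : ∑ T : 𝒯, Real.exp (η * totalRegret erm S st.1 T.1) ≤
    𝒯.card * Real.exp (n * (η * v + 5 / 8 * η ^ 2))
  single : 𝒯.card = 1 → ∀ T : 𝒯, totalRegret erm S st.1 T.1 ≤ n * v

theorem GoodState.zero [Nonempty 𝒯] (H : Set (X → Bool)) (erm : Learner X)
    (S : Fin m → X × Bool) (η v : ℝ) :
    GoodState H erm S η v 0 (Fin.elim0, PMF.uniformOfFintype 𝒯) where
  mem r := r.elim0
  weight T := by simp [totalRegret]
  sum_le := by simp [totalRegret]
  single := by simp [totalRegret]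

theorem empRegret_nonneg {H : Set (X → Bool)} {erm : Learner X} (herm : IsERM H erm)
    (S : Fin m → X × Bool) {h : X → Bool} (hh : h ∈ H) (T : X → X) : 0 ≤ empRegret erm S h T :=
  sub_nonneg.2 ((herm m (transform T S)).2 h hh)

theorem empRegret_le_one (erm : Learner X) (S : Fin m → X × Bool) (h : X → Bool) (T : X → X) :
    empRegret erm S h T ≤ 1 := by
  have h1 := empErr_le_one h (transform T S)
  have h2 := empErr_nonneg (erm m (transform T S)) (transform T S)
  unfold empRegret
  linarith

theorem totalRegret_snoc (erm : Learner X) (S : Fin m → X × Bool) {n : ℕ}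
    (hs : Fin n → X → Bool) (h : X → Bool) (T : X → X) :
    totalRegret erm S (Fin.snoc hs h : Fin (n + 1) → X → Bool) T =
      totalRegret erm S hs T + empRegret erm S h T := by
  simp [totalRegret, Fin.sum_univ_castSucc]

theorem GoodState.succ {H : Set (X → Bool)} {erm : Learner X} (herm : IsERM H erm)
    {S : Fin m → X × Bool} {η v : ℝ} (hη : 0 ≤ η) (hη' : η ≤ 1 / 2) {n : ℕ}
    {st : (Fin n → X → Bool) × PMF 𝒯} (hst : GoodState H erm S η v n st) {h : X → Bool}
    (hh : h ∈ H) (hv : ∑ T : 𝒯, (st.2 T).toReal * empRegret erm S h T.1 ≤ v) :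
    GoodState H erm S η v (n + 1)
      (Fin.snoc st.1 h, mwUpdate η (fun T : 𝒯 => empRegret erm S h T.1) st.2) := by
  set W := ∑ T : 𝒯, Real.exp (η * totalRegret erm S st.1 T.1) with hW
  have h𝒯 : (univ : Finset 𝒯).Nonempty := by
    obtain ⟨T, -⟩ := st.2.support_nonempty
    exact ⟨T, mem_univ T⟩
  have hW0 : 0 < W := sum_pos (fun T _ => Real.exp_pos _) h𝒯
  have hexp : ∀ T : 𝒯, Real.exp (η * totalRegret erm S
      (Fin.snoc st.1 h : Fin (n + 1) → X → Bool) T.1) =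
      W * ((st.2 T).toReal * Real.exp (η * empRegret erm S h T.1)) := fun T => by
    rw [totalRegret_snoc, mul_add, Real.exp_add, hst.weight T, ← hW]
    field_simp
  refine ⟨fun r => ?_, fun T => ?_, ?_, fun h1 T => ?_⟩
  · refine Fin.lastCases ?_ (fun i => ?_) r
    · simpa using hh
    · simpa using hst.mem i
  · simp only [hexp]
    rw [mwUpdate_toReal, ← mul_sum, mul_div_mul_left _ _ hW0.ne']
  · simp only [hexp]
    rw [← mul_sum]
    have h2 := sum_mul_exp_le (fun T => ENNReal.toReal_nonneg) (sum_toReal_eq_one st.2)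
      (fun T : 𝒯 => empRegret_nonneg herm S hh T.1) (fun T => empRegret_le_one erm S h T.1)
      hη hη' hv
    refine (mul_le_mul hst.sum_le h2
      (sum_nonneg fun T _ => mul_nonneg ENNReal.toReal_nonneg (Real.exp_pos _).le)
      (by positivity)).trans_eq ?_
    rw [mul_assoc, ← Real.exp_add]
    congr 2
    push_cast
    ring
  · have h2 := hst.single h1 T
    have hsub : Subsingleton 𝒯 := by
      rw [← Fintype.card_le_one_iff_subsingleton, Fintype.card_coe, h1]
    have huniv : (univ : Finset 𝒯) = {T} := by
      ext T'; simp [Subsingleton.elim T' T]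
    have h3 := sum_toReal_eq_one st.2
    rw [huniv, sum_singleton] at h3 hv
    rw [h3, one_mul] at hv
    change totalRegret erm S (Fin.snoc st.1 h : Fin (n + 1) → X → Bool) T.1 ≤ _
    rw [totalRegret_snoc]
    push_cast
    linarith

/-- The regret bound of multiplicative weights. -/
theorem GoodState.totalRegret_le [Nonempty 𝒯] {H : Set (X → Bool)} {erm : Learner X}
    {S : Fin m → X × Bool} {v : ℝ} {R : ℕ} (hR : 0 < R)
    {st : (Fin R → X → Bool) × PMF 𝒯} {η : ℝ} (hη : η = Real.sqrt (8 * Real.log 𝒯.card / R))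
    (hst : GoodState H erm S η v R st) (T : 𝒯) :
    totalRegret erm S st.1 T.1 ≤ R * (v + 3 / 4 * η) := by
  have hR' : (0 : ℝ) < R := by exact_mod_cast hR
  have hcard : 0 < 𝒯.card := card_pos.2 (nonempty_coe_sort.1 ‹_›)
  rcases Nat.lt_or_ge 1 𝒯.card with h1 | h1
  · have hlog : 0 < Real.log 𝒯.card := Real.log_pos (by exact_mod_cast h1)
    have hη0 : 0 < η := by rw [hη]; positivity
    have hη2 : Real.log 𝒯.card = R * η ^ 2 / 8 := by
      rw [hη, Real.sq_sqrt (by positivity)]; field_simp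
    have h2 := (single_le_sum (f := fun T : 𝒯 => Real.exp (η * totalRegret erm S st.1 T.1))
      (fun T _ => (Real.exp_pos _).le) (mem_univ T)).trans hst.sum_le
    have h3 : ((𝒯.card : ℕ) : ℝ) = Real.exp (R * η ^ 2 / 8) := by
      rw [← hη2, Real.exp_log (by exact_mod_cast hcard)]
    rw [h3, ← Real.exp_add, Real.exp_le_exp] at h2
    refine le_of_mul_le_mul_left (h2.trans_eq ?_) hη0
    ring
  · have h4 : 𝒯.card = 1 := le_antisymm h1 hcard
    have h5 := hst.single h4 T
    have h6 : 0 ≤ R * (3 / 4 * η) := by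
      have : 0 ≤ η := by rw [hη]; exact Real.sqrt_nonneg _
      positivity
    linarith

theorem mixErr_sub_eq_sum_empRegret (erm : Learner X) (S : Fin m → X × Bool) (Q : PMF 𝒯)
    (h : X → Bool) :
    ∑ T : 𝒯, (Q T).toReal * empRegret erm S h T.1 = mixErr S Q h -
      ∑ T : 𝒯, (Q T).toReal * empErr (erm m (transform T.1 S)) (transform T.1 S) := by
  rw [mixErr, ← sum_sub_distrib]
  exact sum_congr rfl fun T _ => by rw [empRegret]; ring

/-- All rounds succeed up to the sum of the failure probabilities of the rounds. -/
theorem rounds_not_goodState_le [Nonempty 𝒯] [NeZero m] {H : Set (X → Bool)} {erm : Learner X}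
    (herm : IsERM H erm) (S : Fin m → X × Bool) {k : ℕ} {η ε v β : ℝ} (hη : 0 ≤ η)
    (hη' : η ≤ 1 / 2) {h₀ : X → Bool} (hh₀ : h₀ ∈ H)
    (hv : ∀ T ∈ 𝒯, empRegret erm S h₀ T + 2 * ε ≤ v)
    (hfail : ∀ Q : PMF 𝒯, (iid (mixture S Q) k).toOuterMeasure
      {s | ∃ h ∈ H, mixErr S Q h + 2 * ε < mixErr S Q (erm k s)} ≤ ENNReal.ofReal β) (n : ℕ) :
    (rounds (𝒯 := 𝒯) erm k η S n).toOuterMeasure {st | ¬ GoodState H erm S η v n st} ≤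
      n * ENNReal.ofReal β := by
  induction n with
  | zero =>
    rw [rounds, PMF.toOuterMeasure_pure_apply, if_neg (by simp [GoodState.zero])]
    exact zero_le
  | succ n ih =>
    rw [rounds, PMF.toOuterMeasure_bind_apply]
    have hstep : ∀ st, rounds (𝒯 := 𝒯) erm k η S n st *
        ((iid (mixture S st.2) k).map fun sample => ((Fin.snoc st.1 (erm k sample) :
          Fin (n + 1) → X → Bool), mwUpdate η (fun T : 𝒯 => empRegret erm S (erm k sample) T.1)
            st.2)).toOuterMeasure {st | ¬ GoodState H erm S η v (n + 1) st} ≤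
        {st | ¬ GoodState H erm S η v n st}.indicator (rounds (𝒯 := 𝒯) erm k η S n) st +
          rounds (𝒯 := 𝒯) erm k η S n st * ENNReal.ofReal β := fun st => by
      by_cases hst : GoodState H erm S η v n st
      · refine le_add_left (mul_le_mul_right ?_ _)
        rw [PMF.toOuterMeasure_map_apply]
        refine ((iid (mixture S st.2) k).toOuterMeasure.mono fun s hs => ?_).trans (hfail st.2)
        by_contra hcon
        simp only [Set.mem_ofPred_eq, not_exists, not_and, not_lt] at hcon
        refine hs (hst.succ herm hη hη' (herm k s).1 ?_)
        have h1 : ∑ T : 𝒯, (st.2 T).toReal * empRegret erm S h₀ T.1 ≤ v - 2 * ε := by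
          calc ∑ T : 𝒯, (st.2 T).toReal * empRegret erm S h₀ T.1
              ≤ ∑ T : 𝒯, (st.2 T).toReal * (v - 2 * ε) := by
                refine sum_le_sum fun T _ => mul_le_mul_of_nonneg_left ?_ ENNReal.toReal_nonneg
                linarith [hv T.1 T.2]
            _ = v - 2 * ε := by rw [← sum_mul, sum_toReal_eq_one, one_mul]
        have h2 := hcon h₀ hh₀
        rw [mixErr_sub_eq_sum_empRegret] at h1 ⊢
        linarith
      · rw [Set.indicator_of_mem (by exact hst)]
        refine le_add_right (mul_le_of_le_one_right zero_le ?_)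
        exact (measure_mono (Set.subset_univ _)).trans_eq
          ((PMF.toOuterMeasure_apply_eq_one_iff _ _).2 (Set.subset_univ _))
    refine (ENNReal.tsum_le_tsum hstep).trans ?_
    rw [ENNReal.tsum_add, ENNReal.tsum_mul_right, PMF.tsum_coe, one_mul,
      ← PMF.toOuterMeasure_apply]
    push_cast
    rw [add_mul, one_mul]
    exact add_le_add_left ih _

end MultiplicativeWeights

/-! ### From empirical to true errors -/

section Generalization

variable {X : Type u} [MeasurableSpace X]

theorem measure_exists_empErr_deviation_le {D : Measure (X × Bool)} [IsProbabilityMeasure D]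
    {𝒞 : Set (X → Bool)} (h𝒞 : IsMeasurableClass D 𝒞) {d m : ℕ} (hm : 0 < m) (hd : vcDim 𝒞 = d)
    {ε δ : ℝ} (hε : 0 < ε) (hδ : 0 < δ) (hδ' : δ ≤ 1 / 2)
    (h : 196608 * (d + Real.log (1 / δ)) ≤ m * ε ^ 2) :
    Measure.pi (fun _ : Fin m => D) {S | ∃ f ∈ 𝒞, ε < |empErr f S - D.real (errorSet f)|} ≤
      ENNReal.ofReal δ := by
  have hm' : (0 : ℝ) < m := by exact_mod_cast hm
  have hmeas : ∀ A ∈ errorSet '' 𝒞, MeasurableSet A := by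
    rintro _ ⟨f, hf, rfl⟩
    exact (measurableSet_eq_fun ((h𝒞.1 f hf).comp measurable_fst) measurable_snd).compl
  have hsup : ∀ e : Fin (m + m) → ℝ, AEMeasurable (fun S : Fin (m + m) → X × Bool =>
      ⨆ A : errorSet '' 𝒞, |∑ i, e i * A.1.indicator (fun _ => (1 : ℝ)) (S i)|)
      (Measure.pi fun _ => D) := fun e => by
    refine (h𝒞.2 (m + m) e).congr (Filter.Eventually.of_forall fun S => ?_)
    let φ : 𝒞 → errorSet '' 𝒞 := fun f => ⟨errorSet f.1, f.1, f.2, rfl⟩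
    have hφ : Function.Surjective φ := by
      rintro ⟨_, f, hf, rfl⟩
      exact ⟨⟨f, hf⟩, rfl⟩
    simp only [loss_eq_indicator]
    exact hφ.iSup_comp fun A : errorSet '' 𝒞 =>
      |∑ i, e i * A.1.indicator (fun _ => (1 : ℝ)) (S i)|
  refine (measure_mono ?_).trans (measure_exists_deviation_le D hmeas (fun s hs => ?_) hsup
    hε hδ hδ' h)
  · rintro S ⟨f, hf, hlt⟩
    refine ⟨_, ⟨f, hf, rfl⟩, ?_⟩
    rw [hits_errorSet hm, ← mul_sub, abs_mul, abs_of_pos hm']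
    exact mul_lt_mul_of_pos_left hlt hm'
  · have := card_le_vcDim_of_setShatters hs
    rw [hd] at this
    exact Nat.cast_le.1 this

theorem opt_le {D : Measure (X × Bool)} {H : Set (X → Bool)} {h : X → Bool} (hh : h ∈ H)
    (T : X → X) : opt D H T ≤ err D h T :=
  ciInf_le ⟨0, by rintro _ ⟨h, rfl⟩; exact measureReal_nonneg⟩ (⟨h, hh⟩ : H)

theorem exists_regret_lt {D : Measure (X × Bool)} {H : Set (X → Bool)} [Nonempty H]
    {𝒯 : Finset (X → X)} {ε : ℝ} (hε : 0 < ε) :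
    ∃ h ∈ H, ∀ T ∈ 𝒯, err D h T - opt D H T ≤ optRegret D H 𝒯 + ε := by
  obtain ⟨h, hh⟩ := exists_lt_of_ciInf_lt
    (show optRegret D H 𝒯 < optRegret D H 𝒯 + ε by linarith)
  refine ⟨h.1, h.2, fun T hT => le_trans ?_ hh.le⟩
  exact le_ciSup (f := fun T : 𝒯 => err D h.1 T - opt D H T) (Set.finite_range _).bddAbove ⟨T, hT⟩

theorem empErr_erm_le {D : Measure (X × Bool)} {H : Set (X → Bool)} [Nonempty H] {erm : Learner X}
    (herm : IsERM H erm) {m : ℕ} {S : Fin m → X × Bool} {T : X → X} {ε : ℝ}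
    (hS : ∀ h ∈ H, |empErr h (transform T S) - err D h T| ≤ ε) :
    empErr (erm m (transform T S)) (transform T S) ≤ opt D H T + ε := by
  refine sub_le_iff_le_add.1 (le_ciInf fun h => ?_)
  have h1 := (abs_le.1 (hS h.1 h.2)).2
  have h2 := (herm m (transform T S)).2 h.1 h.2
  linarith

theorem empRegret_le {D : Measure (X × Bool)} {H : Set (X → Bool)} {erm : Learner X}
    (herm : IsERM H erm) {m : ℕ} {S : Fin m → X × Bool} {T : X → X} {ε : ℝ}
    (hS : ∀ h ∈ H, |empErr h (transform T S) - err D h T| ≤ ε) {h : X → Bool} (hh : h ∈ H) :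
    empRegret erm S h T ≤ err D h T - opt D H T + 2 * ε := by
  have h1 := (abs_le.1 (hS h hh)).2
  have h2 := (abs_le.1 (hS _ (herm m (transform T S)).1)).1
  have h3 := opt_le (D := D) (herm m (transform T S)).1 T
  unfold empRegret
  linarith

theorem avgErr_sub_opt_le {D : Measure (X × Bool)} {H : Set (X → Bool)} [Nonempty H]
    {erm : Learner X} (herm : IsERM H erm) {m : ℕ} {S : Fin m → X × Bool} {T : X → X} {ε : ℝ}
    (hS : ∀ h ∈ H, |empErr h (transform T S) - err D h T| ≤ ε) {R : ℕ} (hR : 0 < R)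
    {h : Fin R → X → Bool} (hh : ∀ r, h r ∈ H) :
    avgErr D h T - opt D H T ≤ totalRegret erm S h T / R + 2 * ε := by
  have hR' : (0 : ℝ) < R := by exact_mod_cast hR
  have h1 := empErr_erm_le herm hS
  have h2 : ∑ r, err D (h r) T ≤ totalRegret erm S h T + R * (opt D H T + 2 * ε) := by
    have : ∀ r ∈ (univ : Finset (Fin R)),
        err D (h r) T ≤ empRegret erm S (h r) T + (opt D H T + 2 * ε) := fun r _ => by
      have h3 := (abs_le.1 (hS _ (hh r))).1
      unfold empRegret
      linarith
    refine (sum_le_sum this).trans_eq ?_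
    rw [sum_add_distrib, totalRegret]
    simp only [sum_const, card_univ, Fintype.card_fin, nsmul_eq_mul]
  have h4 : avgErr D h T ≤ totalRegret erm S h T / R + (opt D H T + 2 * ε) := by
    rw [avgErr, div_le_iff₀ hR', add_mul, div_mul_cancel₀ _ hR'.ne']
    linarith
  linarith

/-- On a representative dataset, the algorithm succeeds with high probability. -/
theorem ofReal_le_algorithm_toOuterMeasure {H : Set (X → Bool)} {𝒯 : Finset (X → X)} [Nonempty 𝒯]
    {D : Measure (X × Bool)} {erm : Learner X} {ε γ : ℝ} {m k R : ℕ} [NeZero m]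
    (herm : IsERM H erm) (hε : 0 < ε) (hε' : ε < 1 / 2) (hγ : 0 < γ) (hγ' : γ < 1 / 2)
    (hR : 0 < R) (hR' : 8 * Real.log 𝒯.card / ε ^ 2 ≤ R)
    (hk : 196608 * ((min (vcDim H) ((m * 𝒯.card : ℕ) : ℕ∞)).toNat + Real.log (R / γ))
      ≤ k * (ε / 32) ^ 2) {S : Fin m → X × Bool}
    (hS : ∀ h ∈ H, ∀ T ∈ 𝒯, |empErr h (transform T S) - err D h T| ≤ ε / 32) :
    ENNReal.ofReal (1 - γ) ≤ (algorithm erm 𝒯 k R S).toOuterMeasure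
      {h | ∀ T ∈ 𝒯, avgErr D h T - opt D H T ≤ optRegret D H 𝒯 + ε} := by
  have hRr : (1 : ℝ) ≤ R := by exact_mod_cast hR
  have hne : Nonempty H := ⟨_, (herm m S).1⟩
  set η := Real.sqrt (8 * Real.log 𝒯.card / R) with hη
  have hη0 : 0 ≤ η := Real.sqrt_nonneg _
  have hηε : η ≤ ε := by
    refine Real.sqrt_le_iff.2 ⟨hε.le, ?_⟩
    rw [div_le_iff₀ (by positivity)] at hR' ⊢
    linarith
  obtain ⟨h₀, hh₀, hreg⟩ := exists_regret_lt (D := D) (H := H) (𝒯 := 𝒯)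
    (show 0 < ε / 100 by positivity)
  set v := optRegret D H 𝒯 + ε / 100 + 4 * (ε / 32) with hv
  have hfail := rounds_not_goodState_le (k := k) (v := v) (ε := ε / 32) (β := γ / R) herm S hη0
    (by linarith) hh₀ (fun T hT => by
      have h1 := empRegret_le herm (fun h hh => hS h hh T hT) hh₀
      have h2 := hreg T hT
      linarith)
    (fun Q => iid_mixture_erm_le herm S Q (by positivity) (by positivity)
      ((div_le_self hγ.le hRr).trans hγ'.le) (by rwa [one_div_div])) R
  have hRγ : (R : ℝ≥0∞) * ENNReal.ofReal (γ / R) = ENNReal.ofReal γ := by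
    rw [← ENNReal.ofReal_natCast, ← ENNReal.ofReal_mul (by positivity)]
    congr 1
    field_simp
  rw [hRγ] at hfail
  rw [algorithm, PMF.toOuterMeasure_map_apply, ENNReal.ofReal_sub _ hγ.le, ENNReal.ofReal_one,
    tsub_le_iff_right]
  set p := rounds (𝒯 := 𝒯) erm k η S R with hp
  have hone : p.toOuterMeasure Set.univ = 1 :=
    (PMF.toOuterMeasure_apply_eq_one_iff _ _).2 (Set.subset_univ _)
  rw [← hone]
  refine le_trans (measure_mono fun st _ => ?_) ((measure_union_le
    (Prod.fst ⁻¹' {h | ∀ T ∈ 𝒯, avgErr D h T - opt D H T ≤ optRegret D H 𝒯 + ε})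
    {st | ¬ GoodState H erm S η v R st}).trans (add_le_add_right hfail _))
  by_cases hst : GoodState H erm S η v R st
  · left
    intro T hT
    have h1 := hst.totalRegret_le hR hη ⟨T, hT⟩
    have h2 := avgErr_sub_opt_le herm (fun h hh => hS h hh T hT) hR hst.mem
    have h3 : totalRegret erm S st.1 T / R ≤ v + 3 / 4 * η := by
      rw [div_le_iff₀ (by linarith)]
      linarith
    linarith
  · right
    exact hst

end Generalization

end TransformationLearning

theorem theorem6 :
    ∃ C : ℝ, 0 < C ∧
      ∀ (X : Type u) [MeasurableSpace X]
        (H : Set (X → Bool)) (𝒯 : Finset (X → X)) [Nonempty 𝒯]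
        (D : Measure (X × Bool)) [IsProbabilityMeasure D]
        (erm : Learner X) (d : ℕ) (ε δ γ : ℝ) (m k R : ℕ) [NeZero m],
        IsMeasurableClass D (compClass H 𝒯) →
        IsERM H erm →
        vcDim (compClass H 𝒯) = d →
        0 < ε → ε < 1 / 2 → 0 < δ → δ < 1 / 2 → 0 < γ → γ < 1 / 2 →
        C * (d + Real.log (1 / δ)) / ε ^ 2 ≤ m →
        0 < R → 8 * Real.log 𝒯.card / ε ^ 2 ≤ R →
        C * ((min (vcDim H) ((m * 𝒯.card : ℕ) : ℕ∞)).toNat + Real.log (R / γ)) / ε ^ 2 ≤ k →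
        (Measure.pi fun _ : Fin m => D)
            {S | ¬ ENNReal.ofReal (1 - γ) ≤
              (algorithm erm 𝒯 k R S).toOuterMeasure
                {h | ∀ T ∈ 𝒯, avgErr D h T - opt D H T ≤ optRegret D H 𝒯 + ε}}
          ≤ ENNReal.ofReal δ := by
  refine ⟨201326592, by norm_num, ?_⟩
  intro X _ H 𝒯 _ D _ erm d ε δ γ m k R _ hclass herm hd hε hε' hδ hδ' hγ hγ' hm hR hR' hk
  rw [div_le_iff₀ (by positivity)] at hm hk
  refine (measure_mono fun S hS => ?_).trans (measure_exists_empErr_deviation_le hclass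
    (NeZero.pos m) hd (ε := ε / 32) (by positivity) hδ hδ'.le (by linarith))
  by_contra hcon
  refine hS (ofReal_le_algorithm_toOuterMeasure herm hε hε' hγ hγ' hR hR' (by linarith)
    fun h hh T hT => ?_)
  by_contra hlt
  exact hcon ⟨h ∘ T, ⟨h, hh, T, hT, rfl⟩, not_le.1 hlt⟩
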